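/- Let $\sigma>0$, $r\ge 0$, $K>0$, $T>0$ and $p\in[1,\infty)$. A Lévy measure is a Borel measure $\nu$ on $\mathbb{R}$ with $\nu(\{0\})=0$ and $\int_{\mathbb{R}}\min(z^2,1)\,\nu(\mathrm{d}z)<\infty$. It is called an admissible activity Lévy measure with shape parameters $\alpha\ge 0$, $D^\pm\in\mathbb{R}$, $\mu\ge 0$ and constant $A>0$ if $\nu(\mathrm{d}z)=h(z)\,\mathrm{d}z$ for a measurable function $h\ge 0$ with $$h(z)\le A|z|^{-\alpha}\left(e^{D^-z}1_{z\ge 0}+e^{D^+z}1_{z<0}\right)e^{-\mu z^2}\qquad (z\ne 0).$$ For such $\nu$ put $$f[u](x)=\int_{\mathbb{R}}\left[u(x+z)-u(x)-(e^z-1)\,\partial_x u(x)\right]\nu(\mathrm{d}z).$$ Let $u_{BS}(\tau,x)=e^{r\tau}V_{BS}(T-\tau,Ke^x)$, where $V_{BS}$ is either the call or the put price in the Black–Scholes model, $$V^{call}_{BS}(t,S)=S\,N(d_1)-Ke^{-r(T-t)}N(d_2),\qquad V^{put}_{BS}(t,S)=Ke^{-r(T-t)}N(-d_2)-S\,N(-d_1),$$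 $$d_{1,2}=\frac{\ln(S/K)+(r\pm\sigma^2/2)(T-t)}{\sigma\sqrt{T-t}},\qquad N(d)=\int_{-\infty}^d\frac{e^{-\xi^2/2}}{\sqrt{2\pi}}\,\mathrm{d}\xi .$$ **Lemma.** Let $0\le\alpha<3$, $A>0$, and let either $\mu>0$ and $D^\pm\in\mathbb{R}$, or $\mu=0$ and $D^-+1<0<D^+$. Suppose that $\frac12\le\gamma<1$ and $\frac{\alpha-1}{2}<\gamma<\frac{p+1}{2p}$. Then there is a constant $C_0>0$, depending only on $p,\sigma,r,T,K$, on $\gamma$ and on the parameters $A,\alpha,D^\pm,\mu$, such that for every admissible activity Lévy measure $\nu$ with shape parameters $\alpha,D^\pm,\mu$ and constant $A$, and for both the call and the put option, the following holds. For every $0<\tau\le T$ the integrals defining $f[u_{BS}(\tau,\cdot)](x)$ and $f[\partial_\tau u_{BS}(\tau,\cdot)](x)$ converge absolutely for every $x\in\mathbb{R}$, the functions $f[u_{BS}(\tau,\cdot)]$ and $f[\partial_\tau u_{BS}(\tau,\cdot)]$ belong to $L^p(\mathbb{R})$, and $$\Vert f[u_{BS}(\tau,\cdot)]\Vert_{L^p}\le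 C_0\,\tau^{-(2\gamma-1)\left(\frac12-\frac1{2p}\right)},\qquad 0<\tau\le T,$$ $$\Vert f[\partial_\tau u_{BS}(\tau,\cdot)]\Vert_{L^p}\le C_0\,\tau^{-\gamma-\frac12+\frac1{2p}},\qquad 0<\tau\le T,$$ $$\Vert f[u_{BS}(\tau_1,\cdot)]-f[u_{BS}(\tau_2,\cdot)]\Vert_{L^p}\le C_0\,|\tau_1-\tau_2|^{-\gamma+\frac{p+1}{2p}},\qquad 0<\tau_1,\tau_2\le T.$$ -/

import Mathlib

open MeasureTheory

noncomputable section

namespace BlackScholesPIDE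

/-- A Lévy measure on the real line: no mass at the origin and `∫ min (z², 1) ν(dz) < ∞`. -/
structure IsLevyMeasure (ν : Measure ℝ) : Prop where
  zero_mass : ν {0} = 0
  lintegral_lt_top : ∫⁻ z, ENNReal.ofReal (min (z ^ 2) 1) ∂ν < ⊤

/-- The bound `A |z|^(-α) (e^{D⁻ z} 1_{z ≥ 0} + e^{D⁺ z} 1_{z < 0}) e^{-μ z²}`. It is used only
for `z ≠ 0`. -/
def levyDensityBound (A α Dminus Dplus μ z : ℝ) : ℝ :=
  A * |z| ^ (-α) * (if 0 ≤ z then Real.exp (Dminus * z) else Real.exp (Dplus * z)) *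
    Real.exp (-μ * z ^ 2)

/-- `ν` is an admissible activity Lévy measure with constant `A > 0` and shape parameters
`α ≥ 0`, `D⁻, D⁺ ∈ ℝ`, `μ ≥ 0`. (At the single point `z = 0` no upper bound is imposed: there the
bound is infinite if `α > 0`, and the value of a density at one point is irrelevant.) -/
structure IsAdmissibleLevyMeasure (ν : Measure ℝ) (A α Dminus Dplus μ : ℝ) : Prop where
  isLevy : IsLevyMeasure ν
  const_pos : 0 < A
  alpha_nonneg : 0 ≤ α
  mu_nonneg : 0 ≤ μ
  exists_density : ∃ h : ℝ → ℝ, Measurable h ∧ (∀ z, 0 ≤ h z) ∧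
    (∀ z, z ≠ 0 → h z ≤ levyDensityBound A α Dminus Dplus μ z) ∧
    ν = (volume : Measure ℝ).withDensity (fun z => ENNReal.ofReal (h z))

/-- `u(x + z) - u(x) - (e^z - 1) u'(x)`. -/
def jumpIntegrand (u : ℝ → ℝ) (x z : ℝ) : ℝ :=
  u (x + z) - u x - (Real.exp z - 1) * deriv u x

/-- The integral `f[u](x)` converges absolutely for every `x`. -/
def JumpIntegrable (ν : Measure ℝ) (u : ℝ → ℝ) : Prop :=
  ∀ x, Integrable (jumpIntegrand u x) ν

/-- The nonlocal operator `f[u](x) = ∫ (u(x + z) - u(x) - (e^z - 1) u'(x)) ν(dz)`. -/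
def jumpOperator (ν : Measure ℝ) (u : ℝ → ℝ) (x : ℝ) : ℝ :=
  ∫ z, jumpIntegrand u x z ∂ν

/-- The standard normal distribution function. -/
def normalCDF (d : ℝ) : ℝ :=
  ∫ ξ in Set.Iic d, Real.exp (-ξ ^ 2 / 2) / Real.sqrt (2 * Real.pi)

/-- `d₁` at time `t` and asset price `S`. -/
def dOne (σ r K T t S : ℝ) : ℝ :=
  (Real.log (S / K) + (r + σ ^ 2 / 2) * (T - t)) / (σ * Real.sqrt (T - t))

/-- `d₂` at time `t` and asset price `S`. -/
def dTwo (σ r K T t S : ℝ) : ℝ :=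
  (Real.log (S / K) + (r - σ ^ 2 / 2) * (T - t)) / (σ * Real.sqrt (T - t))

/-- The two plain vanilla European options. -/
inductive VanillaOption
  | call
  | put

/-- The Black–Scholes price `V_BS(t, S)` of a European call or put option with strike `K` and
maturity `T`. -/
def priceBS (σ r K T : ℝ) : VanillaOption → ℝ → ℝ → ℝ
  | .call, t, S =>
      S * normalCDF (dOne σ r K T t S) -
        K * Real.exp (-r * (T - t)) * normalCDF (dTwo σ r K T t S)
  | .put, t, S =>
      K * Real.exp (-r * (T - t)) * normalCDF (-dTwo σ r K T t S) -
        S * normalCDF (-dOne σ r K T t S)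

/-- The transformed solution `u_BS(τ, x) = e^{rτ} V_BS(T - τ, K e^x)`. -/
def uBS (σ r K T : ℝ) (o : VanillaOption) (τ x : ℝ) : ℝ :=
  Real.exp (r * τ) * priceBS σ r K T o (T - τ) (K * Real.exp x)

/-- The time derivative `∂_τ u_BS(τ, x)`. -/
def dτuBS (σ r K T : ℝ) (o : VanillaOption) (τ x : ℝ) : ℝ :=
  deriv (fun s => uBS σ r K T o s x) τ

end BlackScholesPIDE

end

/-!
Write `c = σ² / 2`. Up to the put-call parity term `ε (e^{x + rτ} - 1)`, which the jump integrand
annihilates, the price `u` is the same for both options, and `g = (∂_x² - ∂_x) u` (`logGamma`) is a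
Gaussian of variance `σ² τ`. Solving `w'' - w' = h` from the initial data `w(x)`, `w'(x)` gives
(`jumpIntegrand_eq_integral`)

  `w(x + z) - w(x) - (e^z - 1) w'(x) = ∫_0^z (e^{z-s} - 1) h(x + s) ds`,

with `h = g` for `w = u` and `h = ∂_τ g` for `w = ∂_τ u`; moreover `∂_τ g = ∂_x G` with
`G = c ∂_x g + (r - c) g` (`logFlux`).

All estimates are made for a fixed jump size `z`. In `L^∞` the integral is at most
`|z| e^{max(z, 0)} min (|z| ‖h‖_∞, ‖h‖_1)`. In `L¹` it is at most `z² e^{max(z, 0)} ‖h‖_1`, and when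
`h = ∂_x G` an integration by parts gives the alternative `2 |z| e^{max(z, 0)} ‖G‖_1`. With the
Gaussian bounds (`exists_gauss_bounds`) each minimum has the form `|z| min (|z| / √τ, 1)`, up to a
power of `τ`, and is at most `|z|^{2γ} τ^{-(2γ - 1) / 2}`. The weight
`(|z|^{2γ} + z²) e^{max(z, 0)}` is integrable uniformly over all admissible Lévy measures because
`2γ - α > -1` and `α < 3` (`exists_lintegral_jumpWeight_le`). So `f[u]` and `f[∂_τ u]` are bounded
in `L¹` by constant multiples of `1` and `τ^{-γ}`, and in `L^∞` by constant multiples of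
`τ^{1/2 - γ}` and `τ^{-1/2 - γ}`; then `‖F‖_p^p ≤ ‖F‖_∞^{p-1} ‖F‖_1` yields the first two estimates.

For the third, the increment of `f[u]` is the time integral of `f[∂_τ u]`, whose `L^p` norm is
`O(τ^{-a})` with `a = γ + 1/2 - 1/(2p) < 1`. Minkowski's integral inequality
(`lintegral_rpow_lintegral_le`) and `∫ τ^{-a} dτ ≤ |τ₁ - τ₂|^{1-a} / (1 - a)` finish the proof.
-/

namespace BlackScholesPIDE

/-! ### Taylor formula for the jump integrand -/

theorem jumpIntegrand_eq_integral {w w₁ w₂ : ℝ → ℝ} (hw : ∀ y, HasDerivAt w (w₁ y) y)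
    (hw₁ : ∀ y, HasDerivAt w₁ (w₂ y) y) (hw₂ : Continuous w₂) (x z : ℝ) :
    jumpIntegrand w x z = ∫ s in 0..z, (Real.exp (z - s) - 1) * (w₂ (x + s) - w₁ (x + s)) := by
  have hcw₁ : Continuous w₁ := continuous_iff_continuousAt.2 fun y => (hw₁ y).continuousAt
  have hd : ∀ s : ℝ, HasDerivAt (fun s => (Real.exp (z - s) - 1) * w₁ (x + s) + w (x + s))
      ((Real.exp (z - s) - 1) * (w₂ (x + s) - w₁ (x + s))) s := by
    intro s
    have h1 : HasDerivAt (fun s => Real.exp (z - s) - 1) (-Real.exp (z - s)) s := by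
      simpa using (((hasDerivAt_id s).const_sub z).exp).sub_const 1
    have h2 : HasDerivAt (fun s => w₁ (x + s)) (w₂ (x + s)) s := (hw₁ (x + s)).comp_const_add x s
    have h3 : HasDerivAt (fun s => w (x + s)) (w₁ (x + s)) s := (hw (x + s)).comp_const_add x s
    refine ((h1.mul h2).add h3).congr_deriv ?_
    ring
  rw [intervalIntegral.integral_eq_sub_of_hasDerivAt (fun s _ => hd s)
    (Continuous.intervalIntegrable (by fun_prop) _ _)]
  simp only [jumpIntegrand, (hw x).deriv]
  simp
  ring

/-- Integration by parts moves the derivative off `G`; this is what makes the jump integrand of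
`∂_τ u` of first instead of second order in `z`. -/
theorem integral_exp_sub_one_mul_deriv {G G' : ℝ → ℝ} (hG : ∀ y, HasDerivAt G (G' y) y)
    (hG' : Continuous G') (x z : ℝ) :
    ∫ s in 0..z, (Real.exp (z - s) - 1) * G' (x + s) =
      (∫ s in 0..z, Real.exp (z - s) * G (x + s)) - (Real.exp z - 1) * G x := by
  have hcG : Continuous G := continuous_iff_continuousAt.2 fun y => (hG y).continuousAt
  have hd : ∀ s : ℝ, HasDerivAt (fun s => (Real.exp (z - s) - 1) * G (x + s))
      ((Real.exp (z - s) - 1) * G' (x + s) - Real.exp (z - s) * G (x + s)) s := by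
    intro s
    have h1 : HasDerivAt (fun s => Real.exp (z - s) - 1) (-Real.exp (z - s)) s := by
      simpa using (((hasDerivAt_id s).const_sub z).exp).sub_const 1
    have h2 : HasDerivAt (fun s => G (x + s)) (G' (x + s)) s := (hG (x + s)).comp_const_add x s
    refine (h1.mul h2).congr_deriv ?_
    ring
  have h := intervalIntegral.integral_eq_sub_of_hasDerivAt (a := 0) (b := z) (fun s _ => hd s)
    (Continuous.intervalIntegrable (by fun_prop) _ _)
  rw [intervalIntegral.integral_sub (Continuous.intervalIntegrable (by fun_prop) _ _)
    (Continuous.intervalIntegrable (by fun_prop) _ _)] at h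
  simp at h
  linarith

/-! ### Elementary bounds -/

theorem abs_exp_sub_one_le (z : ℝ) : |Real.exp z - 1| ≤ |z| * Real.exp (max z 0) := by
  rcases le_total 0 z with hz | hz
  · have h1 : (1 : ℝ) ≤ Real.exp z := Real.one_le_exp hz
    rw [abs_of_nonneg (by linarith), abs_of_nonneg hz, max_eq_left hz]
    have h2 := Real.add_one_le_exp (-z)
    have h3 : Real.exp (-z) * Real.exp z = 1 := by rw [← Real.exp_add]; simp
    nlinarith [Real.exp_pos z]
  · have h1 : Real.exp z ≤ 1 := Real.exp_le_one_iff.2 hz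
    rw [abs_of_nonpos (by linarith), abs_of_nonpos hz, max_eq_right hz]
    have h2 := Real.add_one_le_exp z
    simp
    linarith

theorem abs_exp_sub_sub_one_le {z s : ℝ} (hs : s ∈ Set.uIoc 0 z) :
    |Real.exp (z - s) - 1| ≤ |z| * Real.exp (max z 0) := by
  refine (abs_exp_sub_one_le _).trans ?_
  have h : |z - s| ≤ |z| ∧ z - s ≤ max z 0 := by
    rcases le_total 0 z with hz | hz
    · rw [Set.uIoc_of_le hz] at hs
      obtain ⟨h1, h2⟩ := hs
      refine ⟨?_, le_max_of_le_left (by linarith)⟩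
      rw [abs_of_nonneg (by linarith), abs_of_nonneg hz]; linarith
    · rw [Set.uIoc_of_ge hz] at hs
      obtain ⟨h1, h2⟩ := hs
      refine ⟨?_, le_max_of_le_right (by linarith)⟩
      rw [abs_of_nonpos (by linarith), abs_of_nonpos hz]; linarith
  have h2 : max (z - s) 0 ≤ max z 0 := max_le h.2 (le_max_right _ _)
  exact mul_le_mul h.1 (Real.exp_le_exp.2 h2) (Real.exp_pos _).le (abs_nonneg _)

theorem abs_exp_sub_le {z s : ℝ} (hs : s ∈ Set.uIoc 0 z) :
    |Real.exp (z - s)| ≤ Real.exp (max z 0) := by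
  rw [abs_of_pos (Real.exp_pos _), Real.exp_le_exp]
  rcases le_total 0 z with hz | hz
  · rw [Set.uIoc_of_le hz] at hs
    exact le_max_of_le_left (by linarith [hs.1])
  · rw [Set.uIoc_of_ge hz] at hs
    exact le_max_of_le_right (by linarith [hs.1])

/-- The interpolation `min (t, 1) ≤ t ^ (2γ - 1)`, with `t = ζ / q`, between the behaviour of the
jump integrand for jumps below and above the diffusive scale `q`. -/
theorem mul_min_le_rpow {γ ζ q : ℝ} (hγ : 1 / 2 ≤ γ) (hγ' : γ < 1) (hζ : 0 ≤ ζ) (hq : 0 < q) :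
    ζ * min (ζ / q) 1 ≤ ζ ^ (2 * γ) * q ^ (-(2 * γ - 1)) := by
  rcases hζ.eq_or_lt with rfl | hζ
  · simp only [zero_mul]; positivity
  have h1 : min (ζ / q) 1 ≤ (ζ / q) ^ (2 * γ - 1) := by
    have ht : 0 < ζ / q := by positivity
    rcases le_total (ζ / q) 1 with h | h
    · rw [min_eq_left h]
      conv_lhs => rw [← Real.rpow_one (ζ / q)]
      exact Real.rpow_le_rpow_of_exponent_ge ht h (by linarith)
    · rw [min_eq_right h]
      exact Real.one_le_rpow h (by linarith)
  calc ζ * min (ζ / q) 1 ≤ ζ * (ζ / q) ^ (2 * γ - 1) := by gcongr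
    _ = ζ ^ (2 * γ) * q ^ (-(2 * γ - 1)) := by
      rw [Real.div_rpow hζ.le hq.le, Real.rpow_neg hq.le, div_eq_mul_inv, ← mul_assoc]
      congr 1
      conv_lhs => rw [← Real.rpow_one_add' hζ.le (by linarith)]
      ring_nf

/-! ### Uniform and `L¹` bounds for truncated convolutions -/

theorem enorm_integral_mul_le {a h : ℝ → ℝ} {z M : ℝ} (x : ℝ)
    (ha : ∀ s ∈ Set.uIoc 0 z, |a s| ≤ M) :
    ‖∫ s in 0..z, a s * h (x + s)‖ₑ ≤
      ENNReal.ofReal M * ∫⁻ s in Set.uIoc 0 z, ‖h (x + s)‖ₑ := by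
  have h1 : ‖∫ s in 0..z, a s * h (x + s)‖ₑ = ‖∫ s in Set.uIoc 0 z, a s * h (x + s)‖ₑ := by
    rw [← ofReal_norm, ← ofReal_norm, intervalIntegral.norm_intervalIntegral_eq]
  rw [h1]
  refine (enorm_integral_le_lintegral_enorm _).trans ?_
  rw [← lintegral_const_mul' _ _ ENNReal.ofReal_ne_top]
  refine setLIntegral_mono_ae' measurableSet_uIoc (ae_of_all _ fun s hs => ?_)
  rw [enorm_mul]
  gcongr
  rw [Real.enorm_eq_ofReal_abs]
  exact ENNReal.ofReal_le_ofReal (ha s hs)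

/-- The supremum of a truncated convolution is controlled both by the supremum `S` of `h` and by
its `L¹` norm. -/
theorem abs_integral_mul_le_min {a h : ℝ → ℝ} {z M S L : ℝ} (x : ℝ) (hM : 0 ≤ M) (hL : 0 ≤ L)
    (ha : ∀ s ∈ Set.uIoc 0 z, |a s| ≤ M) (hS : ∀ y, |h y| ≤ S)
    (hhL : ∫⁻ y, ‖h y‖ₑ ≤ ENNReal.ofReal L) :
    |∫ s in 0..z, a s * h (x + s)| ≤ M * min (|z| * S) L := by
  have hS0 : 0 ≤ S := (abs_nonneg _).trans (hS 0)
  rw [mul_min_of_nonneg _ _ hM]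
  refine le_min ?_ ?_
  · have := intervalIntegral.norm_integral_le_of_norm_le_const (a := 0) (b := z) (C := M * S)
      (f := fun s => a s * h (x + s)) (fun s hs => by
        rw [Real.norm_eq_abs, abs_mul]
        exact mul_le_mul (ha s hs) (hS _) (abs_nonneg _) hM)
    rw [Real.norm_eq_abs, sub_zero] at this
    linarith
  · have h1 := enorm_integral_mul_le (h := h) x ha
    have h2 : ∫⁻ s in Set.uIoc 0 z, ‖h (x + s)‖ₑ ≤ ENNReal.ofReal L := by
      refine (setLIntegral_le_lintegral _ _).trans ?_
      rwa [lintegral_add_left_eq_self (fun y => ‖h y‖ₑ) x]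
    have h3 := h1.trans (mul_le_mul_right h2 _)
    rwa [← ENNReal.ofReal_mul hM, Real.enorm_eq_ofReal_abs,
      ENNReal.ofReal_le_ofReal_iff (by positivity)] at h3

theorem lintegral_enorm_integral_mul_le {a h : ℝ → ℝ} {z M L : ℝ} (hM : 0 ≤ M)
    (ha : ∀ s ∈ Set.uIoc 0 z, |a s| ≤ M) (hh : Measurable h)
    (hhL : ∫⁻ y, ‖h y‖ₑ ≤ ENNReal.ofReal L) :
    ∫⁻ x, ‖∫ s in 0..z, a s * h (x + s)‖ₑ ≤ ENNReal.ofReal (|z| * M * L) := by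
  calc ∫⁻ x, ‖∫ s in 0..z, a s * h (x + s)‖ₑ
      ≤ ∫⁻ x, ENNReal.ofReal M * ∫⁻ s in Set.uIoc 0 z, ‖h (x + s)‖ₑ :=
        lintegral_mono fun x => enorm_integral_mul_le x ha
    _ = ENNReal.ofReal M * ∫⁻ s in Set.uIoc 0 z, ∫⁻ x, ‖h (x + s)‖ₑ := by
        rw [lintegral_const_mul' _ _ ENNReal.ofReal_ne_top, lintegral_lintegral_swap]
        exact (hh.comp (measurable_fst.add measurable_snd)).enorm.aemeasurable
    _ = ENNReal.ofReal M * (ENNReal.ofReal |z| * ∫⁻ y, ‖h y‖ₑ) := by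
        simp_rw [lintegral_add_right_eq_self (fun y => ‖h y‖ₑ)]
        rw [setLIntegral_const, Real.volume_uIoc, sub_zero, mul_comm (ENNReal.ofReal |z|)]
    _ ≤ ENNReal.ofReal M * (ENNReal.ofReal |z| * ENNReal.ofReal L) := by gcongr
    _ = ENNReal.ofReal (|z| * M * L) := by
        rw [← ENNReal.ofReal_mul (abs_nonneg z), ← ENNReal.ofReal_mul hM]
        ring_nf

/-! ### Interpolation between `L¹` and `L^∞`, and integration in time -/

theorem lintegral_rpow_le_of_le {Φ : ℝ → ENNReal} {p S L : ℝ} (hp : 1 ≤ p) (hS : 0 ≤ S)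
    (hΦS : ∀ x, Φ x ≤ ENNReal.ofReal S) (hΦL : ∫⁻ x, Φ x ≤ ENNReal.ofReal L) :
    ∫⁻ x, Φ x ^ p ≤ ENNReal.ofReal (S ^ (p - 1) * L) := by
  have hp' : 0 ≤ p - 1 := by linarith
  calc ∫⁻ x, Φ x ^ p ≤ ∫⁻ x, ENNReal.ofReal S ^ (p - 1) * Φ x := by
        refine lintegral_mono fun x => ?_
        have : Φ x ^ p = Φ x ^ (p - 1) * Φ x := by
          conv_rhs => rw [← ENNReal.rpow_one (Φ x), ← ENNReal.rpow_mul, one_mul]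
          rw [← ENNReal.rpow_add_of_nonneg _ _ hp' zero_le_one]
          ring_nf
        simp only [this]
        gcongr
        exact hΦS x
    _ = ENNReal.ofReal (S ^ (p - 1)) * ∫⁻ x, Φ x := by
        rw [ENNReal.ofReal_rpow_of_nonneg hS hp', lintegral_const_mul' _ _ ENNReal.ofReal_ne_top]
    _ ≤ ENNReal.ofReal (S ^ (p - 1)) * ENNReal.ofReal L := by gcongr
    _ = _ := (ENNReal.ofReal_mul (by positivity)).symm

/-- A form of Minkowski's integral inequality: if `‖Φ(τ, ·)‖_{L^p} ≤ C τ^{-a}`, then the `L^p`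
norm of `∫ Φ(τ, ·) dτ` is at most `C ∫ τ^{-a} dτ`. Hölder's inequality is applied in `τ`
with the weight `τ^{-a}`. -/
theorem lintegral_rpow_lintegral_le {Φ : ℝ → ℝ → ENNReal} {p a C t₁ t₂ : ℝ}
    (hΦ : Measurable (Function.uncurry Φ)) (hp : 1 ≤ p) (hC : 0 ≤ C) (ht₂ : 0 < t₂)
    (hbound : ∀ τ ∈ Set.Ioc t₂ t₁, ∫⁻ x, Φ τ x ^ p ≤ ENNReal.ofReal (C ^ p * τ ^ (-a * p))) :
    ∫⁻ x, (∫⁻ τ in Set.Ioc t₂ t₁, Φ τ x) ^ p ≤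
      ENNReal.ofReal (C ^ p) * (∫⁻ τ in Set.Ioc t₂ t₁, ENNReal.ofReal (τ ^ (-a))) ^ p := by
  have hp0 : 0 < p := by linarith
  set I := ∫⁻ τ in Set.Ioc t₂ t₁, ENNReal.ofReal (τ ^ (-a)) with hI
  have hmeas : Measurable fun τ : ℝ => ENNReal.ofReal (τ ^ (-a)) := by fun_prop
  have hmeas' : Measurable fun τ : ℝ => ENNReal.ofReal (τ ^ (a * (p - 1))) := by fun_prop
  have hΦx : ∀ x, Measurable fun τ => Φ τ x := fun x => hΦ.comp (measurable_id.prodMk measurable_const)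
  have hH : ∀ x, (∫⁻ τ in Set.Ioc t₂ t₁, Φ τ x) ^ p ≤
      (∫⁻ τ in Set.Ioc t₂ t₁, ENNReal.ofReal (τ ^ (a * (p - 1))) * Φ τ x ^ p) * I ^ (p - 1) := by
    intro x
    have h := ENNReal.lintegral_mul_norm_pow_le (μ := volume.restrict (Set.Ioc t₂ t₁))
      (f := fun τ => ENNReal.ofReal (τ ^ (a * (p - 1))) * Φ τ x ^ p)
      (g := fun τ => ENNReal.ofReal (τ ^ (-a)))
      (hmeas'.mul ((hΦx x).pow_const p)).aemeasurable hmeas.aemeasurable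
      (p := 1 / p) (q := 1 - 1 / p) (by positivity)
      (by rw [sub_nonneg, div_le_one hp0]; exact hp) (by ring)
    have h' : ∫⁻ τ in Set.Ioc t₂ t₁, Φ τ x = ∫⁻ τ in Set.Ioc t₂ t₁,
        (ENNReal.ofReal (τ ^ (a * (p - 1))) * Φ τ x ^ p) ^ (1 / p) *
          ENNReal.ofReal (τ ^ (-a)) ^ (1 - 1 / p) := by
      refine setLIntegral_congr_fun measurableSet_Ioc fun τ hτ => ?_
      have hτ0 : 0 < τ := ht₂.trans hτ.1
      have e1 : ENNReal.ofReal (τ ^ (a * (p - 1))) ^ (1 / p) *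
          ENNReal.ofReal (τ ^ (-a)) ^ (1 - 1 / p) = 1 := by
        rw [ENNReal.ofReal_rpow_of_pos (by positivity), ENNReal.ofReal_rpow_of_pos (by positivity),
          ← ENNReal.ofReal_mul (by positivity), ← Real.rpow_mul hτ0.le, ← Real.rpow_mul hτ0.le,
          ← Real.rpow_add hτ0]
        have : a * (p - 1) * (1 / p) + -a * (1 - 1 / p) = 0 := by field_simp; ring
        rw [this]; simp
      have e2 : (Φ τ x ^ p) ^ (1 / p) = Φ τ x := by
        rw [← ENNReal.rpow_mul, mul_one_div_cancel hp0.ne', ENNReal.rpow_one]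
      rw [ENNReal.mul_rpow_of_nonneg _ _ (by positivity), e2, mul_right_comm, e1, one_mul]
    rw [← h'] at h
    have h2 := ENNReal.rpow_le_rpow h hp0.le
    rw [ENNReal.mul_rpow_of_nonneg _ _ hp0.le, ← ENNReal.rpow_mul, ← ENNReal.rpow_mul,
      one_div_mul_cancel hp0.ne', ENNReal.rpow_one] at h2
    have e3 : (1 - 1 / p) * p = p - 1 := by field_simp
    rwa [e3] at h2
  have hswap : ∫⁻ x, ∫⁻ τ in Set.Ioc t₂ t₁, ENNReal.ofReal (τ ^ (a * (p - 1))) * Φ τ x ^ p =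
      ∫⁻ τ in Set.Ioc t₂ t₁, ∫⁻ x, ENNReal.ofReal (τ ^ (a * (p - 1))) * Φ τ x ^ p := by
    refine lintegral_lintegral_swap (Measurable.aemeasurable ?_)
    exact (hmeas'.comp measurable_snd).mul ((hΦ.comp measurable_swap).pow_const p)
  have hin : ∫⁻ τ in Set.Ioc t₂ t₁, ∫⁻ x, ENNReal.ofReal (τ ^ (a * (p - 1))) * Φ τ x ^ p ≤
      ENNReal.ofReal (C ^ p) * I := by
    rw [hI, ← lintegral_const_mul' _ _ ENNReal.ofReal_ne_top]
    refine setLIntegral_mono_ae' measurableSet_Ioc (ae_of_all _ fun τ hτ => ?_)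
    have hτ0 : 0 < τ := ht₂.trans hτ.1
    rw [lintegral_const_mul' _ _ ENNReal.ofReal_ne_top, ← ENNReal.ofReal_mul (by positivity)]
    refine (mul_le_mul_right (hbound τ hτ) _).trans_eq ?_
    rw [← ENNReal.ofReal_mul (by positivity)]
    congr 1
    rw [mul_left_comm, ← Real.rpow_add hτ0]
    congr 2
    ring
  calc ∫⁻ x, (∫⁻ τ in Set.Ioc t₂ t₁, Φ τ x) ^ p
      ≤ ∫⁻ x, (∫⁻ τ in Set.Ioc t₂ t₁, ENNReal.ofReal (τ ^ (a * (p - 1))) * Φ τ x ^ p) *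
          I ^ (p - 1) := lintegral_mono hH
    _ = (∫⁻ x, ∫⁻ τ in Set.Ioc t₂ t₁, ENNReal.ofReal (τ ^ (a * (p - 1))) * Φ τ x ^ p) *
          I ^ (p - 1) := by
        refine lintegral_mul_const _ (Measurable.lintegral_prod_right' (f := fun q : ℝ × ℝ =>
          ENNReal.ofReal (q.2 ^ (a * (p - 1))) * Φ q.2 q.1 ^ p) ?_)
        exact (hmeas'.comp measurable_snd).mul ((hΦ.comp measurable_swap).pow_const p)
    _ ≤ ENNReal.ofReal (C ^ p) * I * I ^ (p - 1) := by
        rw [hswap]; gcongr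
    _ = ENNReal.ofReal (C ^ p) * I ^ p := by
        have e : I ^ p = I * I ^ (p - 1) := by
          conv_rhs => rw [← ENNReal.rpow_one I, ← ENNReal.rpow_mul, one_mul]
          rw [← ENNReal.rpow_add_of_nonneg _ _ zero_le_one (by linarith)]
          ring_nf
        rw [e, mul_assoc]

theorem setLIntegral_rpow_neg_le {a t₁ t₂ : ℝ} (ha : 0 ≤ a) (ha' : a < 1) (ht₂ : 0 < t₂)
    (h : t₂ ≤ t₁) :
    ∫⁻ τ in Set.Ioc t₂ t₁, ENNReal.ofReal (τ ^ (-a)) ≤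
      ENNReal.ofReal ((t₁ - t₂) ^ (1 - a) / (1 - a)) := by
  have hint : IntervalIntegrable (fun τ : ℝ => τ ^ (-a)) volume t₂ t₁ :=
    intervalIntegral.intervalIntegrable_rpow' (by linarith)
  rw [← ofReal_integral_eq_lintegral_ofReal ((intervalIntegrable_iff_integrableOn_Ioc_of_le h).1 hint)
    (by
      filter_upwards [ae_restrict_mem measurableSet_Ioc] with τ hτ
      exact Real.rpow_nonneg (ht₂.trans hτ.1).le _),
    ← intervalIntegral.integral_of_le h, integral_rpow (Or.inl (by linarith))]
  have e : -a + 1 = 1 - a := by ring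
  rw [e]
  have h1 : 0 < 1 - a := by linarith
  have := Real.rpow_add_le_add_rpow (a := t₁ - t₂) (b := t₂) (p := 1 - a) (by linarith) ht₂.le
    h1.le (by linarith)
  rw [sub_add_cancel] at this
  apply ENNReal.ofReal_le_ofReal
  gcongr
  linarith

/-! ### The standard normal distribution -/

/-- The standard normal density. -/
noncomputable def normalPDF (d : ℝ) : ℝ :=
  Real.exp (-d ^ 2 / 2) / Real.sqrt (2 * Real.pi)

theorem normalPDF_eq_gaussianPDFReal : normalPDF = ProbabilityTheory.gaussianPDFReal 0 1 := by
  ext d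
  simp [normalPDF, ProbabilityTheory.gaussianPDFReal, div_eq_inv_mul]

theorem continuous_normalPDF : Continuous normalPDF := by
  unfold normalPDF; fun_prop

theorem integrable_normalPDF : Integrable normalPDF := by
  rw [normalPDF_eq_gaussianPDFReal]
  exact ProbabilityTheory.integrable_gaussianPDFReal 0 1

theorem hasDerivAt_normalPDF (d : ℝ) : HasDerivAt normalPDF (-d * normalPDF d) d := by
  have h : HasDerivAt (fun d : ℝ => -d ^ 2 / 2) (-d) d := by
    refine (((hasDerivAt_pow 2 d).neg).div_const 2).congr_deriv ?_
    norm_num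
    ring
  refine (h.exp.div_const (Real.sqrt (2 * Real.pi))).congr_deriv ?_
  simp only [normalPDF]
  ring

theorem hasDerivAt_normalCDF (d : ℝ) : HasDerivAt normalCDF (normalPDF d) d := by
  have h : normalCDF = fun d => normalCDF 0 + ∫ ξ in (0 : ℝ)..d, normalPDF ξ := by
    ext d
    have := intervalIntegral.integral_Iic_sub_Iic (a := 0) (b := d)
      integrable_normalPDF.integrableOn integrable_normalPDF.integrableOn
    rw [← this]
    simp [normalCDF, normalPDF]
  rw [h]
  exact ((continuous_normalPDF.integral_hasStrictDerivAt 0 d).hasDerivAt).const_add _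

theorem continuous_normalCDF : Continuous normalCDF :=
  continuous_iff_continuousAt.2 fun d => (hasDerivAt_normalCDF d).continuousAt

theorem normalCDF_neg (d : ℝ) : normalCDF (-d) = 1 - normalCDF d := by
  have h1 : normalCDF (-d) = ∫ ξ in Set.Ioi d, normalPDF ξ := by
    have := integral_comp_neg_Ioi d normalPDF
    rw [normalCDF]
    rw [show (fun ξ : ℝ => Real.exp (-ξ ^ 2 / 2) / Real.sqrt (2 * Real.pi)) = normalPDF from rfl,
      ← this]
    simp [normalPDF]
  have h2 := intervalIntegral.integral_Iic_add_Ioi (b := d)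
    integrable_normalPDF.integrableOn integrable_normalPDF.integrableOn
  have h3 : ∫ ξ, normalPDF ξ = 1 := by
    rw [normalPDF_eq_gaussianPDFReal]
    exact ProbabilityTheory.integral_gaussianPDFReal_eq_one 0 one_ne_zero
  rw [h3] at h2
  rw [h1, ← h2]
  simp [normalCDF, normalPDF]

/-! ### Derivatives of the Black–Scholes price in logarithmic variables -/

/-- `d₁` in the variables `τ = T - t`, `x = log (S / K)`. -/
noncomputable def logDOne (σ r τ x : ℝ) : ℝ := (x + (r + σ ^ 2 / 2) * τ) / (σ * Real.sqrt τ)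

/-- `d₂` in the variables `τ = T - t`, `x = log (S / K)`. -/
noncomputable def logDTwo (σ r τ x : ℝ) : ℝ := (x + (r - σ ^ 2 / 2) * τ) / (σ * Real.sqrt τ)

/-- The Black–Scholes price in logarithmic variables, for the call (`ε = 0`) and, by put-call
parity, for the put (`ε = -K`). -/
noncomputable def logPrice (σ r K ε τ x : ℝ) : ℝ :=
  K * (Real.exp (x + r * τ) * normalCDF (logDOne σ r τ x) - normalCDF (logDTwo σ r τ x)) +
    ε * (Real.exp (x + r * τ) - 1)

/-- The first space derivative of `logPrice`. -/
noncomputable def logDelta (σ r K ε τ x : ℝ) : ℝ :=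
  Real.exp (x + r * τ) * (K * normalCDF (logDOne σ r τ x) + ε)

/-- The Gaussian `(∂_x² - ∂_x) u` for `u = logPrice`. -/
noncomputable def logGamma (σ r K τ x : ℝ) : ℝ :=
  K * normalPDF (logDTwo σ r τ x) / (σ * Real.sqrt τ)

/-- The first space derivative of `logGamma`. -/
noncomputable def logGammaDeriv (σ r K τ x : ℝ) : ℝ :=
  -logDTwo σ r τ x / (σ * Real.sqrt τ) * logGamma σ r K τ x

/-- The second space derivative of `logGamma`. -/
noncomputable def logGammaDerivTwo (σ r K τ x : ℝ) : ℝ :=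
  (logDTwo σ r τ x ^ 2 - 1) / (σ * Real.sqrt τ) ^ 2 * logGamma σ r K τ x

/-- The time derivative of `logPrice`, from the Black–Scholes equation
`∂_τ u = (σ² / 2) (∂_x² - ∂_x) u + r ∂_x u`. -/
noncomputable def logTheta (σ r K ε τ x : ℝ) : ℝ :=
  σ ^ 2 / 2 * logGamma σ r K τ x + r * logDelta σ r K ε τ x

/-- The mixed derivative `∂_τ ∂_x` of `logPrice`. -/
noncomputable def logThetaDeriv (σ r K ε τ x : ℝ) : ℝ :=
  σ ^ 2 / 2 * logGammaDeriv σ r K τ x + r * (logDelta σ r K ε τ x + logGamma σ r K τ x)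

/-- The constant in the put-call parity representation `logPrice`. -/
def parityConst (K : ℝ) : VanillaOption → ℝ
  | .call => 0
  | .put => -K

theorem uBS_eq_logPrice (σ r T : ℝ) {K : ℝ} (hK : 0 < K) (o : VanillaOption) (τ : ℝ) :
    uBS σ r K T o τ = logPrice σ r K (parityConst K o) τ := by
  ext x
  have hl : Real.log (K * Real.exp x / K) = x := by
    rw [mul_div_cancel_left₀ _ hK.ne', Real.log_exp]
  have h1 : dOne σ r K T (T - τ) (K * Real.exp x) = logDOne σ r τ x := by
    simp only [dOne, logDOne, hl, sub_sub_cancel]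
  have h2 : dTwo σ r K T (T - τ) (K * Real.exp x) = logDTwo σ r τ x := by
    simp only [dTwo, logDTwo, hl, sub_sub_cancel]
  have h3 : Real.exp (r * τ) * Real.exp (-r * τ) = 1 := by
    rw [← Real.exp_add]; simp
  cases o
  · simp only [uBS, priceBS, h1, h2, logPrice, parityConst, sub_sub_cancel, Real.exp_add]
    linear_combination (-K * normalCDF (logDTwo σ r τ x)) * h3
  · simp only [uBS, priceBS, h1, h2, logPrice, parityConst, sub_sub_cancel, Real.exp_add,
      normalCDF_neg]
    linear_combination (K * (1 - normalCDF (logDTwo σ r τ x))) * h3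

section Derivatives

variable {σ τ : ℝ} (r K ε : ℝ)

theorem logDOne_eq (hσ : 0 < σ) (hτ : 0 < τ) (x : ℝ) :
    logDOne σ r τ x = logDTwo σ r τ x + σ * Real.sqrt τ := by
  have hs : 0 < Real.sqrt τ := Real.sqrt_pos.2 hτ
  have hq : Real.sqrt τ ^ 2 = τ := Real.sq_sqrt hτ.le
  simp only [logDOne, logDTwo]
  field_simp
  linear_combination (-2 * σ ^ 2) * hq

/-- The identity behind all Black–Scholes greeks. -/
theorem exp_mul_normalPDF_logDOne (hσ : 0 < σ) (hτ : 0 < τ) (x : ℝ) :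
    Real.exp (x + r * τ) * normalPDF (logDOne σ r τ x) = normalPDF (logDTwo σ r τ x) := by
  have hs : 0 < Real.sqrt τ := Real.sqrt_pos.2 hτ
  have hq : Real.sqrt τ ^ 2 = τ := Real.sq_sqrt hτ.le
  have h : x + r * τ + -logDOne σ r τ x ^ 2 / 2 = -logDTwo σ r τ x ^ 2 / 2 := by
    have h2 : logDTwo σ r τ x * (σ * Real.sqrt τ) = x + (r - σ ^ 2 / 2) * τ :=
      div_mul_cancel₀ _ (by positivity)
    rw [logDOne_eq r hσ hτ]
    linear_combination -h2 - σ ^ 2 / 2 * hq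
  simp only [normalPDF]
  rw [← mul_div_assoc, ← Real.exp_add, h]

theorem hasDerivAt_logDOne (x : ℝ) :
    HasDerivAt (logDOne σ r τ) (1 / (σ * Real.sqrt τ)) x :=
  ((hasDerivAt_id x).add_const _).div_const _

theorem hasDerivAt_logDTwo (x : ℝ) :
    HasDerivAt (logDTwo σ r τ) (1 / (σ * Real.sqrt τ)) x :=
  ((hasDerivAt_id x).add_const _).div_const _

theorem hasDerivAt_exp_add (x : ℝ) :
    HasDerivAt (fun x => Real.exp (x + r * τ)) (Real.exp (x + r * τ)) x := by
  simpa using ((hasDerivAt_id x).add_const (r * τ)).exp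

theorem hasDerivAt_logPrice (hσ : 0 < σ) (hτ : 0 < τ) (x : ℝ) :
    HasDerivAt (logPrice σ r K ε τ) (logDelta σ r K ε τ x) x := by
  have h1 := (hasDerivAt_normalCDF (logDOne σ r τ x)).comp x (hasDerivAt_logDOne r x)
  have h2 := (hasDerivAt_normalCDF (logDTwo σ r τ x)).comp x (hasDerivAt_logDTwo r x)
  have h3 := hasDerivAt_exp_add (τ := τ) r x
  refine ((((h3.mul h1).sub h2).const_mul K).add ((h3.sub_const 1).const_mul ε)).congr_deriv ?_
  simp only [logDelta, Function.comp]
  linear_combination K / (σ * Real.sqrt τ) * exp_mul_normalPDF_logDOne r hσ hτ x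

theorem hasDerivAt_logDelta (hσ : 0 < σ) (hτ : 0 < τ) (x : ℝ) :
    HasDerivAt (logDelta σ r K ε τ) (logDelta σ r K ε τ x + logGamma σ r K τ x) x := by
  have h1 := (hasDerivAt_normalCDF (logDOne σ r τ x)).comp x (hasDerivAt_logDOne r x)
  have h3 := hasDerivAt_exp_add (τ := τ) r x
  refine (h3.mul ((h1.const_mul K).add_const ε)).congr_deriv ?_
  simp only [logDelta, logGamma, Function.comp]
  linear_combination K / (σ * Real.sqrt τ) * exp_mul_normalPDF_logDOne r hσ hτ x

theorem hasDerivAt_logGamma (x : ℝ) :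
    HasDerivAt (logGamma σ r K τ) (logGammaDeriv σ r K τ x) x := by
  have h2 := (hasDerivAt_normalPDF (logDTwo σ r τ x)).comp x (hasDerivAt_logDTwo r x)
  refine ((h2.const_mul K).div_const (σ * Real.sqrt τ)).congr_deriv ?_
  simp only [logGamma, logGammaDeriv]
  ring

theorem hasDerivAt_logGammaDeriv (x : ℝ) :
    HasDerivAt (logGammaDeriv σ r K τ) (logGammaDerivTwo σ r K τ x) x := by
  have h2 := hasDerivAt_logDTwo (σ := σ) (τ := τ) r x
  refine ((h2.neg.div_const (σ * Real.sqrt τ)).mul (hasDerivAt_logGamma r K x)).congr_deriv ?_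
  simp only [logGammaDeriv, logGammaDerivTwo, Pi.neg_apply]
  ring

theorem hasDerivAt_logTheta (hσ : 0 < σ) (hτ : 0 < τ) (x : ℝ) :
    HasDerivAt (logTheta σ r K ε τ) (logThetaDeriv σ r K ε τ x) x :=
  ((hasDerivAt_logGamma r K x).const_mul _).add
    ((hasDerivAt_logDelta r K ε hσ hτ x).const_mul r)

theorem hasDerivAt_logThetaDeriv (hσ : 0 < σ) (hτ : 0 < τ) (x : ℝ) :
    HasDerivAt (logThetaDeriv σ r K ε τ)
      (σ ^ 2 / 2 * logGammaDerivTwo σ r K τ x +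
        r * (logDelta σ r K ε τ x + logGamma σ r K τ x + logGammaDeriv σ r K τ x)) x :=
  ((hasDerivAt_logGammaDeriv r K x).const_mul _).add
    (((hasDerivAt_logDelta r K ε hσ hτ x).add (hasDerivAt_logGamma r K x)).const_mul r)

theorem hasDerivAt_logDTwo_time (hσ : 0 < σ) (hτ : 0 < τ) (x : ℝ) :
    HasDerivAt (fun τ => logDTwo σ r τ x)
      ((r - σ ^ 2 / 2) / (σ * Real.sqrt τ) - logDTwo σ r τ x / (2 * τ)) τ := by
  have hs : 0 < Real.sqrt τ := Real.sqrt_pos.2 hτ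
  have hq : Real.sqrt τ ^ 2 = τ := Real.sq_sqrt hτ.le
  have h1 := (((hasDerivAt_id τ).const_mul (r - σ ^ 2 / 2)).const_add x).div
    ((Real.hasDerivAt_sqrt hτ.ne').const_mul σ) (by positivity)
  refine h1.congr_deriv ?_
  simp only [logDTwo, id]
  field_simp
  rw [hq]

theorem hasDerivAt_logDOne_time (hσ : 0 < σ) (hτ : 0 < τ) (x : ℝ) :
    HasDerivAt (fun τ => logDOne σ r τ x)
      ((r - σ ^ 2 / 2) / (σ * Real.sqrt τ) - logDTwo σ r τ x / (2 * τ) +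
        σ / (2 * Real.sqrt τ)) τ := by
  have h1 := (hasDerivAt_logDTwo_time r hσ hτ x).add
    ((Real.hasDerivAt_sqrt hτ.ne').const_mul σ)
  refine (h1.congr_of_eventuallyEq ?_).congr_deriv (by ring)
  filter_upwards [lt_mem_nhds hτ] with s hs
  exact logDOne_eq r hσ hs x

theorem hasDerivAt_exp_add_time (x : ℝ) :
    HasDerivAt (fun τ => Real.exp (x + r * τ)) (r * Real.exp (x + r * τ)) τ := by
  have := (((hasDerivAt_id τ).const_mul r).const_add x).exp
  refine this.congr_deriv ?_
  simp [mul_comm]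

theorem hasDerivAt_logPrice_time (hσ : 0 < σ) (hτ : 0 < τ) (x : ℝ) :
    HasDerivAt (fun τ => logPrice σ r K ε τ x) (logTheta σ r K ε τ x) τ := by
  have hs : 0 < Real.sqrt τ := Real.sqrt_pos.2 hτ
  have h1 := (hasDerivAt_normalCDF (logDOne σ r τ x)).comp τ (hasDerivAt_logDOne_time r hσ hτ x)
  have h2 := (hasDerivAt_normalCDF (logDTwo σ r τ x)).comp τ (hasDerivAt_logDTwo_time r hσ hτ x)
  have h3 := hasDerivAt_exp_add_time (τ := τ) r x
  refine ((((h3.mul h1).sub h2).const_mul K).add ((h3.sub_const 1).const_mul ε)).congr_deriv ?_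
  have hv : σ / (2 * Real.sqrt τ) = σ ^ 2 / 2 / (σ * Real.sqrt τ) := by field_simp
  simp only [logTheta, logDelta, logGamma, Function.comp]
  rw [hv]
  linear_combination K * ((r - σ ^ 2 / 2) / (σ * Real.sqrt τ) - logDTwo σ r τ x / (2 * τ) +
        σ ^ 2 / 2 / (σ * Real.sqrt τ)) * exp_mul_normalPDF_logDOne r hσ hτ x

theorem hasDerivAt_logDelta_time (hσ : 0 < σ) (hτ : 0 < τ) (x : ℝ) :
    HasDerivAt (fun τ => logDelta σ r K ε τ x) (logThetaDeriv σ r K ε τ x) τ := by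
  have hs : 0 < Real.sqrt τ := Real.sqrt_pos.2 hτ
  have hq : Real.sqrt τ ^ 2 = τ := Real.sq_sqrt hτ.le
  have h1 := (hasDerivAt_normalCDF (logDOne σ r τ x)).comp τ (hasDerivAt_logDOne_time r hσ hτ x)
  have h3 := hasDerivAt_exp_add_time (τ := τ) r x
  refine (h3.mul ((h1.const_mul K).add_const ε)).congr_deriv ?_
  have hv : σ / (2 * Real.sqrt τ) = σ ^ 2 / 2 / (σ * Real.sqrt τ) := by field_simp
  have hw : 1 / (2 * τ) = σ ^ 2 / 2 / (σ * Real.sqrt τ) ^ 2 := by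
    rw [mul_pow, hq]; field_simp
  have hw' : logDTwo σ r τ x / (2 * τ) =
      logDTwo σ r τ x * (σ ^ 2 / 2 / (σ * Real.sqrt τ) ^ 2) := by rw [← hw]; ring
  simp only [logThetaDeriv, logDelta, logGamma, logGammaDeriv, Function.comp]
  rw [hv, hw']
  linear_combination K * ((r - σ ^ 2 / 2) / (σ * Real.sqrt τ) -
      logDTwo σ r τ x * (σ ^ 2 / 2 / (σ * Real.sqrt τ) ^ 2) +
        σ ^ 2 / 2 / (σ * Real.sqrt τ)) * exp_mul_normalPDF_logDOne r hσ hτ x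

theorem dτuBS_eq_logTheta (hσ : 0 < σ) (hK : 0 < K) (T : ℝ) (o : VanillaOption) (hτ : 0 < τ) :
    dτuBS σ r K T o τ = logTheta σ r K (parityConst K o) τ := by
  ext x
  simp only [dτuBS, uBS_eq_logPrice σ r T hK]
  exact (hasDerivAt_logPrice_time r K _ hσ hτ x).deriv

end Derivatives

/-! ### The jump integrand of the Black–Scholes price -/

section JumpIntegrand

variable {σ τ : ℝ} (r K ε : ℝ)

theorem continuous_logGamma : Continuous (logGamma σ r K τ) :=
  continuous_iff_continuousAt.2 fun x => (hasDerivAt_logGamma r K x).continuousAt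

theorem continuous_logGammaDeriv : Continuous (logGammaDeriv σ r K τ) :=
  continuous_iff_continuousAt.2 fun x => (hasDerivAt_logGammaDeriv r K x).continuousAt

theorem continuous_logGammaDerivTwo : Continuous (logGammaDerivTwo σ r K τ) := by
  have h := continuous_logGamma (σ := σ) (τ := τ) r K
  unfold logGammaDerivTwo logDTwo
  fun_prop

theorem continuous_logDelta (hσ : 0 < σ) (hτ : 0 < τ) : Continuous (logDelta σ r K ε τ) :=
  continuous_iff_continuousAt.2 fun x => (hasDerivAt_logDelta r K ε hσ hτ x).continuousAt

theorem jumpIntegrand_logPrice (hσ : 0 < σ) (hτ : 0 < τ) (x z : ℝ) :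
    jumpIntegrand (logPrice σ r K ε τ) x z =
      ∫ s in 0..z, (Real.exp (z - s) - 1) * logGamma σ r K τ (x + s) := by
  rw [jumpIntegrand_eq_integral (hasDerivAt_logPrice r K ε hσ hτ)
    (hasDerivAt_logDelta r K ε hσ hτ)
    ((continuous_logDelta r K ε hσ hτ).add (continuous_logGamma r K))]
  simp

/-- The function `G = (σ² / 2) ∂_x g + (r - σ² / 2) g` with `g = logGamma`, for which
`∂_τ g = ∂_x G`. -/
noncomputable def logFlux (σ r K τ x : ℝ) : ℝ :=
  σ ^ 2 / 2 * logGammaDeriv σ r K τ x + (r - σ ^ 2 / 2) * logGamma σ r K τ x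

/-- The space derivative of `logFlux`; it is also the time derivative of `logGamma`. -/
noncomputable def logFluxDeriv (σ r K τ x : ℝ) : ℝ :=
  σ ^ 2 / 2 * logGammaDerivTwo σ r K τ x + (r - σ ^ 2 / 2) * logGammaDeriv σ r K τ x

theorem hasDerivAt_logFlux (x : ℝ) : HasDerivAt (logFlux σ r K τ) (logFluxDeriv σ r K τ x) x :=
  ((hasDerivAt_logGammaDeriv r K x).const_mul _).add ((hasDerivAt_logGamma r K x).const_mul _)

theorem continuous_logFlux : Continuous (logFlux σ r K τ) :=
  continuous_iff_continuousAt.2 fun x => (hasDerivAt_logFlux r K x).continuousAt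

theorem continuous_logFluxDeriv : Continuous (logFluxDeriv σ r K τ) :=
  ((continuous_logGammaDerivTwo r K).const_mul _).add ((continuous_logGammaDeriv r K).const_mul _)

theorem jumpIntegrand_logTheta (hσ : 0 < σ) (hτ : 0 < τ) (x z : ℝ) :
    jumpIntegrand (logTheta σ r K ε τ) x z =
      ∫ s in 0..z, (Real.exp (z - s) - 1) * logFluxDeriv σ r K τ (x + s) := by
  rw [jumpIntegrand_eq_integral (hasDerivAt_logTheta r K ε hσ hτ)
    (hasDerivAt_logThetaDeriv r K ε hσ hτ)
    (((continuous_logGammaDerivTwo r K).const_mul _).add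
      ((((continuous_logDelta r K ε hσ hτ).add (continuous_logGamma r K)).add
        (continuous_logGammaDeriv r K)).const_mul _))]
  congr 1
  ext s
  simp only [logFluxDeriv, logThetaDeriv]
  ring

/-- The integrand of `f[∂_τ u]` written without derivatives as a function of `(τ, x, z)`. -/
noncomputable def thetaJump (σ r K ε τ x z : ℝ) : ℝ :=
  logTheta σ r K ε τ (x + z) - logTheta σ r K ε τ x -
    (Real.exp z - 1) * logThetaDeriv σ r K ε τ x

theorem jumpIntegrand_logTheta_eq_thetaJump (hσ : 0 < σ) (hτ : 0 < τ) (x z : ℝ) :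
    jumpIntegrand (logTheta σ r K ε τ) x z = thetaJump σ r K ε τ x z := by
  rw [jumpIntegrand, (hasDerivAt_logTheta r K ε hσ hτ x).deriv, thetaJump]

/-- The integrand of `f[u]` written without derivatives as a function of `(τ, x, z)`. -/
noncomputable def priceJump (σ r K ε τ x z : ℝ) : ℝ :=
  logPrice σ r K ε τ (x + z) - logPrice σ r K ε τ x -
    (Real.exp z - 1) * logDelta σ r K ε τ x

theorem jumpIntegrand_logPrice_eq_priceJump (hσ : 0 < σ) (hτ : 0 < τ) (x z : ℝ) :
    jumpIntegrand (logPrice σ r K ε τ) x z = priceJump σ r K ε τ x z := by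
  rw [jumpIntegrand, (hasDerivAt_logPrice r K ε hσ hτ x).deriv, priceJump]

theorem hasDerivAt_priceJump_time (hσ : 0 < σ) (hτ : 0 < τ) (x z : ℝ) :
    HasDerivAt (fun τ => priceJump σ r K ε τ x z) (thetaJump σ r K ε τ x z) τ :=
  ((hasDerivAt_logPrice_time r K ε hσ hτ (x + z)).sub
    (hasDerivAt_logPrice_time r K ε hσ hτ x)).sub
    ((hasDerivAt_logDelta_time r K ε hσ hτ x).const_mul _)

theorem measurable_logDelta : Measurable fun q : ℝ × ℝ => logDelta σ r K ε q.1 q.2 := by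
  have h := continuous_normalCDF.measurable
  unfold logDelta logDOne
  fun_prop

theorem measurable_logGamma : Measurable fun q : ℝ × ℝ => logGamma σ r K q.1 q.2 := by
  have h := continuous_normalPDF.measurable
  unfold logGamma logDTwo
  fun_prop

theorem measurable_logPrice : Measurable fun q : ℝ × ℝ => logPrice σ r K ε q.1 q.2 := by
  have h := continuous_normalCDF.measurable
  unfold logPrice logDOne logDTwo
  fun_prop

theorem measurable_logTheta : Measurable fun q : ℝ × ℝ => logTheta σ r K ε q.1 q.2 :=
  ((measurable_logGamma r K).const_mul _).add ((measurable_logDelta r K ε).const_mul _)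

theorem measurable_logThetaDeriv : Measurable fun q : ℝ × ℝ => logThetaDeriv σ r K ε q.1 q.2 := by
  have h1 := measurable_logDelta (σ := σ) r K ε
  have h2 := measurable_logGamma (σ := σ) r K
  unfold logThetaDeriv logGammaDeriv logDTwo
  fun_prop

theorem measurable_priceJump :
    Measurable fun q : ℝ × ℝ × ℝ => priceJump σ r K ε q.1 q.2.1 q.2.2 := by
  have h1 := measurable_logDelta (σ := σ) r K ε
  have h2 := measurable_logPrice (σ := σ) r K ε
  unfold priceJump
  exact ((h2.comp (by fun_prop : Measurable fun q : ℝ × ℝ × ℝ => (q.1, q.2.1 + q.2.2))).sub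
    (h2.comp (by fun_prop : Measurable fun q : ℝ × ℝ × ℝ => (q.1, q.2.1)))).sub
    ((by fun_prop : Measurable fun q : ℝ × ℝ × ℝ => Real.exp q.2.2 - 1).mul
      (h1.comp (by fun_prop : Measurable fun q : ℝ × ℝ × ℝ => (q.1, q.2.1))))

theorem measurable_thetaJump :
    Measurable fun q : ℝ × ℝ × ℝ => thetaJump σ r K ε q.1 q.2.1 q.2.2 := by
  have h1 := measurable_logThetaDeriv (σ := σ) r K ε
  have h2 := measurable_logTheta (σ := σ) r K ε
  unfold thetaJump
  exact ((h2.comp (by fun_prop : Measurable fun q : ℝ × ℝ × ℝ => (q.1, q.2.1 + q.2.2))).sub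
    (h2.comp (by fun_prop : Measurable fun q : ℝ × ℝ × ℝ => (q.1, q.2.1)))).sub
    ((by fun_prop : Measurable fun q : ℝ × ℝ × ℝ => Real.exp q.2.2 - 1).mul
      (h1.comp (by fun_prop : Measurable fun q : ℝ × ℝ × ℝ => (q.1, q.2.1))))

theorem measurable_priceJump_comp {β : Type*} [MeasurableSpace β] {f g h : β → ℝ}
    (hf : Measurable f) (hg : Measurable g) (hh : Measurable h) :
    Measurable fun b => priceJump σ r K ε (f b) (g b) (h b) := by
  have := (measurable_priceJump (σ := σ) r K ε).comp (hf.prodMk (hg.prodMk hh))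
  simpa only [Function.comp_def] using this

theorem measurable_thetaJump_comp {β : Type*} [MeasurableSpace β] {f g h : β → ℝ}
    (hf : Measurable f) (hg : Measurable g) (hh : Measurable h) :
    Measurable fun b => thetaJump σ r K ε (f b) (g b) (h b) := by
  have := (measurable_thetaJump (σ := σ) r K ε).comp (hf.prodMk (hg.prodMk hh))
  simpa only [Function.comp_def] using this

end JumpIntegrand

/-! ### A weight integrable against all admissible Lévy measures -/

/-- The weight `(|z|^{2γ} + z²) e^{max(z, 0)}`, which dominates the norms of the jump integrands
as functions of the jump size `z`. -/
noncomputable def jumpWeight (γ z : ℝ) : ℝ :=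
  (|z| ^ (2 * γ) + z ^ 2) * Real.exp (max z 0)

theorem jumpWeight_nonneg (γ z : ℝ) : 0 ≤ jumpWeight γ z := by
  unfold jumpWeight; positivity

theorem measurable_jumpWeight (γ : ℝ) : Measurable (jumpWeight γ) := by
  unfold jumpWeight; fun_prop

theorem rpow_mul_exp_le_jumpWeight (γ z : ℝ) :
    |z| ^ (2 * γ) * Real.exp (max z 0) ≤ jumpWeight γ z := by
  unfold jumpWeight
  gcongr
  nlinarith [sq_nonneg z]

theorem sq_mul_exp_le_jumpWeight (γ z : ℝ) :
    z ^ 2 * Real.exp (max z 0) ≤ jumpWeight γ z := by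
  unfold jumpWeight
  have : 0 ≤ |z| ^ (2 * γ) := by positivity
  gcongr
  linarith

theorem integrable_abs_rpow_mul_exp_neg {s δ : ℝ} (hs : -1 < s) (hδ : 0 < δ) :
    Integrable fun z : ℝ => |z| ^ s * Real.exp (-δ * |z|) := by
  have h1 : IntegrableOn (fun z : ℝ => |z| ^ s * Real.exp (-δ * |z|)) (Set.Ioi 0) := by
    refine (integrableOn_rpow_mul_exp_neg_mul_rpow hs one_pos hδ).congr_fun (fun z hz => ?_)
      measurableSet_Ioi
    simp only [Real.rpow_one, abs_of_pos (Set.mem_Ioi.1 hz)]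
  rw [← integrableOn_univ, ← @Set.Iio_union_Ici _ _ (0 : ℝ), integrableOn_union,
    integrableOn_Ici_iff_integrableOn_Ioi]
  refine ⟨?_, h1⟩
  rw [← (Measure.measurePreserving_neg (volume : Measure ℝ)).integrableOn_comp_preimage
      (Homeomorph.neg ℝ).measurableEmbedding]
  simpa only [Function.comp_def, abs_neg, Set.neg_preimage, Set.neg_Iio, neg_zero] using h1

/-- In both admissible parameter regimes the exponential factors of the density dominate the
growth `e^{max(z, 0)}` of the weight. -/
theorem exists_exp_tail_le {Dminus Dplus μ : ℝ}
    (hshape : 0 < μ ∨ (μ = 0 ∧ Dminus + 1 < 0 ∧ 0 < Dplus)) :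
    ∃ δ B : ℝ, 0 < δ ∧ 0 ≤ B ∧ ∀ z : ℝ,
      Real.exp (max z 0) * (if 0 ≤ z then Real.exp (Dminus * z) else Real.exp (Dplus * z)) *
        Real.exp (-μ * z ^ 2) ≤ B * Real.exp (-δ * |z|) := by
  have key : ∃ δ b : ℝ, 0 < δ ∧ ∀ z : ℝ,
      max z 0 + (if 0 ≤ z then Dminus * z else Dplus * z) + -μ * z ^ 2 ≤ b + -δ * |z| := by
    rcases hshape with hμ | ⟨rfl, h1, h2⟩
    · -- completing the square in `c |z| - μ z²`
      set c := |Dminus| + |Dplus| + 2 with hc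
      refine ⟨1, c ^ 2 / (4 * μ), one_pos, fun z => ?_⟩
      have hsq : c * |z| - μ * z ^ 2 ≤ c ^ 2 / (4 * μ) := by
        rw [le_div_iff₀ (by positivity), ← sq_abs z]
        nlinarith [sq_nonneg (c - 2 * μ * |z|)]
      have hlin : max z 0 + (if 0 ≤ z then Dminus * z else Dplus * z) ≤ c * |z| - |z| := by
        split_ifs with hz
        · rw [max_eq_left hz, abs_of_nonneg hz]
          nlinarith [le_abs_self Dminus, abs_nonneg Dplus]
        · rw [max_eq_right (by linarith), abs_of_neg (by linarith)]
          nlinarith [neg_abs_le Dplus, abs_nonneg Dminus]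
      linarith
    · refine ⟨min (-(Dminus + 1)) Dplus, 0, lt_min (by linarith) h2, fun z => ?_⟩
      have hm1 := min_le_left (-(Dminus + 1)) Dplus
      have hm2 := min_le_right (-(Dminus + 1)) Dplus
      split_ifs with hz
      · rw [max_eq_left hz, abs_of_nonneg hz]
        nlinarith
      · rw [max_eq_right (by linarith), abs_of_neg (by linarith)]
        nlinarith
  obtain ⟨δ, b, hδ, h⟩ := key
  refine ⟨δ, Real.exp b, hδ, (Real.exp_pos b).le, fun z => ?_⟩
  rw [← apply_ite Real.exp, ← Real.exp_add, ← Real.exp_add, ← Real.exp_add]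
  exact Real.exp_le_exp.2 (h z)

/-- The condition `γ > (α - 1) / 2` enters here: it makes `|z|^{2γ - α}` integrable at `0`. -/
theorem exists_lintegral_jumpWeight_le {A α Dminus Dplus μ γ : ℝ} (hα : α < 3)
    (hshape : 0 < μ ∨ (μ = 0 ∧ Dminus + 1 < 0 ∧ 0 < Dplus)) (hγ : (α - 1) / 2 < γ) :
    ∃ I : ℝ, 0 < I ∧ ∀ ν : Measure ℝ, IsAdmissibleLevyMeasure ν A α Dminus Dplus μ →
      ∫⁻ z, ENNReal.ofReal (jumpWeight γ z) ∂ν ≤ ENNReal.ofReal I := by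
  obtain ⟨δ, B, hδ, hB, htail⟩ := exists_exp_tail_le hshape
  set D : ℝ → ℝ := fun z => |A| * B * (|z| ^ (2 * γ - α) * Real.exp (-δ * |z|) +
    |z| ^ (2 - α) * Real.exp (-δ * |z|)) with hD
  have hDint : Integrable D := ((integrable_abs_rpow_mul_exp_neg (by linarith) hδ).add
    (integrable_abs_rpow_mul_exp_neg (by linarith) hδ)).const_mul _
  have hDnn : ∀ z, 0 ≤ D z := fun z => by simp only [hD]; positivity
  have hInn : 0 ≤ ∫ z, D z := integral_nonneg hDnn
  refine ⟨(∫ z, D z) + 1, by linarith, fun ν hν => ?_⟩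
  obtain ⟨h, hmeas, hnn, hle, rfl⟩ := hν.exists_density
  rw [lintegral_withDensity_eq_lintegral_mul _ hmeas.ennreal_ofReal
    (measurable_jumpWeight γ).ennreal_ofReal]
  calc ∫⁻ z, ((fun z => ENNReal.ofReal (h z)) * fun z => ENNReal.ofReal (jumpWeight γ z)) z
      ≤ ∫⁻ z, ENNReal.ofReal (D z) := by
        refine lintegral_mono_ae ?_
        filter_upwards [compl_mem_ae_iff.2 (measure_singleton (0 : ℝ))] with z hz
        have hz0 : z ≠ 0 := hz
        have hzp : 0 < |z| := abs_pos.2 hz0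
        simp only [Pi.mul_apply]
        rw [← ENNReal.ofReal_mul (hnn z)]
        refine ENNReal.ofReal_le_ofReal ?_
        set e := if 0 ≤ z then Real.exp (Dminus * z) else Real.exp (Dplus * z) with he
        have he0 : 0 ≤ e := by rw [he]; split_ifs <;> exact (Real.exp_pos _).le
        have hb : h z ≤ |A| * (|z| ^ (-α) * e * Real.exp (-μ * z ^ 2)) := by
          refine (hle z hz0).trans ?_
          rw [levyDensityBound, ← he, mul_assoc, mul_assoc, mul_assoc (|z| ^ (-α))]
          exact mul_le_mul_of_nonneg_right (le_abs_self A) (by positivity)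
        calc h z * jumpWeight γ z
            ≤ |A| * (|z| ^ (-α) * e * Real.exp (-μ * z ^ 2)) * jumpWeight γ z :=
              mul_le_mul_of_nonneg_right hb (jumpWeight_nonneg γ z)
          _ = |A| * (|z| ^ (-α) * (|z| ^ (2 * γ) + z ^ 2)) *
                (Real.exp (max z 0) * e * Real.exp (-μ * z ^ 2)) := by
              unfold jumpWeight; ring
          _ ≤ |A| * (|z| ^ (-α) * (|z| ^ (2 * γ) + z ^ 2)) * (B * Real.exp (-δ * |z|)) :=
              mul_le_mul_of_nonneg_left (htail z) (by positivity)
          _ = D z := by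
              have e1 : |z| ^ (-α) * |z| ^ (2 * γ) = |z| ^ (2 * γ - α) := by
                rw [← Real.rpow_add hzp]; ring_nf
              have e2 : |z| ^ (-α) * z ^ 2 = |z| ^ (2 - α) := by
                rw [← sq_abs z, ← Real.rpow_two, ← Real.rpow_add hzp]; ring_nf
              simp only [hD]
              rw [mul_add, e1, e2]; ring
    _ = ENNReal.ofReal (∫ z, D z) :=
        (ofReal_integral_eq_lintegral_ofReal hDint (ae_of_all _ hDnn)).symm
    _ ≤ _ := ENNReal.ofReal_le_ofReal (by linarith)

/-! ### Gaussian bounds -/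

/-- A wider Gaussian that dominates `logGamma` and, up to powers of `σ √τ`, its derivatives. -/
noncomputable def gaussEnvelope (σ r K τ x : ℝ) : ℝ :=
  K / σ * Real.exp (-logDTwo σ r τ x ^ 2 / 4) / Real.sqrt τ

section GaussBounds

variable {σ r K τ : ℝ}

theorem gaussEnvelope_nonneg (hσ : 0 < σ) (hK : 0 < K) (x : ℝ) :
    0 ≤ gaussEnvelope σ r K τ x := by
  unfold gaussEnvelope; positivity

theorem gaussEnvelope_le (hσ : 0 < σ) (hK : 0 < K) (x : ℝ) :
    gaussEnvelope σ r K τ x ≤ K / σ / Real.sqrt τ := by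
  unfold gaussEnvelope
  have : Real.exp (-logDTwo σ r τ x ^ 2 / 4) ≤ 1 :=
    Real.exp_le_one_iff.2 (by nlinarith [sq_nonneg (logDTwo σ r τ x)])
  gcongr
  exact mul_le_of_le_one_right (by positivity) this

theorem lintegral_gaussEnvelope (hσ : 0 < σ) (hK : 0 < K) (hτ : 0 < τ) :
    ∫⁻ x, ENNReal.ofReal (gaussEnvelope σ r K τ x) =
      ENNReal.ofReal (2 * K * Real.sqrt Real.pi) := by
  have hs : 0 < Real.sqrt τ := Real.sqrt_pos.2 hτ
  set b := 1 / (2 * σ * Real.sqrt τ) ^ 2 with hb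
  have hb0 : 0 < b := by positivity
  have heq : gaussEnvelope σ r K τ = fun x => K / σ / Real.sqrt τ *
      Real.exp (-b * (x + (r - σ ^ 2 / 2) * τ) ^ 2) := by
    ext x
    have : -logDTwo σ r τ x ^ 2 / 4 = -b * (x + (r - σ ^ 2 / 2) * τ) ^ 2 := by
      simp only [logDTwo, hb]; field_simp; ring
    rw [gaussEnvelope, this]; ring
  have hint : Integrable (gaussEnvelope σ r K τ) := by
    rw [heq]
    exact ((integrable_exp_neg_mul_sq hb0).comp_add_right _).const_mul _
  rw [← ofReal_integral_eq_lintegral_ofReal hint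
    (ae_of_all _ fun x => gaussEnvelope_nonneg hσ hK x), heq, integral_const_mul,
    integral_add_right_eq_self fun x => Real.exp (-b * x ^ 2), integral_gaussian]
  congr 1
  have : Real.pi / b = Real.pi * (2 * σ * Real.sqrt τ) ^ 2 := by rw [hb]; field_simp
  rw [this, Real.sqrt_mul Real.pi_pos.le, Real.sqrt_sq (by positivity)]
  field_simp

theorem abs_logGamma_mul_le (hσ : 0 < σ) (hK : 0 < K) {q M : ℝ} {x : ℝ}
    (hM : |q| ≤ M * Real.exp (logDTwo σ r τ x ^ 2 / 4)) :
    |q * logGamma σ r K τ x| ≤ M * gaussEnvelope σ r K τ x := by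
  set d := logDTwo σ r τ x with hd
  have hM0 : 0 ≤ M := nonneg_of_mul_nonneg_left ((abs_nonneg q).trans hM) (Real.exp_pos _)
  have hpi : (1 : ℝ) ≤ Real.sqrt (2 * Real.pi) := by
    rw [Real.one_le_sqrt]; linarith [Real.pi_gt_three]
  have hpdf : normalPDF d ≤ Real.exp (-d ^ 2 / 2) := div_le_self (Real.exp_pos _).le hpi
  have hpdf0 : 0 ≤ normalPDF d := by unfold normalPDF; positivity
  have hg0 : 0 ≤ logGamma σ r K τ x := by unfold logGamma; positivity
  have hg : logGamma σ r K τ x ≤ K / σ * Real.exp (-d ^ 2 / 2) / Real.sqrt τ := by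
    have : logGamma σ r K τ x = K / σ * normalPDF d / Real.sqrt τ := by
      rw [logGamma, ← hd, div_mul_eq_div_div]; ring
    rw [this]; gcongr
  rw [abs_mul, abs_of_nonneg hg0]
  calc |q| * logGamma σ r K τ x
      ≤ M * Real.exp (d ^ 2 / 4) * (K / σ * Real.exp (-d ^ 2 / 2) / Real.sqrt τ) := by gcongr
    _ = M * (K / σ * (Real.exp (d ^ 2 / 4) * Real.exp (-d ^ 2 / 2)) / Real.sqrt τ) := by ring
    _ = M * gaussEnvelope σ r K τ x := by
        rw [← Real.exp_add, gaussEnvelope, ← hd]; ring_nf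

theorem abs_logGamma_le (hσ : 0 < σ) (hK : 0 < K) (x : ℝ) :
    |logGamma σ r K τ x| ≤ gaussEnvelope σ r K τ x := by
  have h := abs_logGamma_mul_le (σ := σ) (r := r) (K := K) (τ := τ) (q := 1) (M := 1) (x := x)
    hσ hK (by rw [abs_one, one_mul]; exact Real.one_le_exp (by positivity))
  simpa using h

theorem abs_logGammaDeriv_le (hσ : 0 < σ) (hK : 0 < K) (hτ : 0 < τ) (x : ℝ) :
    |logGammaDeriv σ r K τ x| ≤ 1 / (σ * Real.sqrt τ) * gaussEnvelope σ r K τ x := by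
  have hs : 0 < Real.sqrt τ := Real.sqrt_pos.2 hτ
  refine abs_logGamma_mul_le hσ hK ?_
  set d := logDTwo σ r τ x
  have h := Real.add_one_le_exp (d ^ 2 / 4)
  rw [abs_div, abs_neg, abs_of_pos (by positivity : 0 < σ * Real.sqrt τ), one_div_mul_eq_div]
  gcongr
  nlinarith [sq_nonneg (|d| - 2), sq_abs d]

theorem abs_logGammaDerivTwo_le (hσ : 0 < σ) (hK : 0 < K) (hτ : 0 < τ) (x : ℝ) :
    |logGammaDerivTwo σ r K τ x| ≤ 4 / (σ ^ 2 * τ) * gaussEnvelope σ r K τ x := by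
  have hs : 0 < Real.sqrt τ := Real.sqrt_pos.2 hτ
  refine abs_logGamma_mul_le hσ hK ?_
  set d := logDTwo σ r τ x
  have h := Real.add_one_le_exp (d ^ 2 / 4)
  have hq : (σ * Real.sqrt τ) ^ 2 = σ ^ 2 * τ := by rw [mul_pow, Real.sq_sqrt hτ.le]
  rw [hq, abs_div, abs_of_pos (by positivity : 0 < σ ^ 2 * τ), div_mul_eq_mul_div]
  gcongr
  rw [abs_le]
  constructor <;> nlinarith [sq_nonneg d]

theorem lintegral_enorm_le_of_abs_le (hσ : 0 < σ) (hK : 0 < K) (hτ : 0 < τ) {h : ℝ → ℝ} {M : ℝ}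
    (hM : 0 ≤ M) (hh : ∀ x, |h x| ≤ M * gaussEnvelope σ r K τ x) :
    ∫⁻ x, ‖h x‖ₑ ≤ ENNReal.ofReal (M * (2 * K * Real.sqrt Real.pi)) := by
  rw [ENNReal.ofReal_mul hM, ← lintegral_gaussEnvelope (r := r) hσ hK hτ,
    ← lintegral_const_mul' _ _ ENNReal.ofReal_ne_top]
  refine lintegral_mono fun x => ?_
  rw [Real.enorm_eq_ofReal_abs, ← ENNReal.ofReal_mul hM]
  exact ENNReal.ofReal_le_ofReal (hh x)

end GaussBounds

/-- Heat-kernel bounds on a finite time interval: each space derivative costs a factor `τ^{-1/2}`,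
and passing from `L¹` to `L^∞` costs another one. -/
theorem exists_gauss_bounds {σ K : ℝ} (r : ℝ) {T : ℝ} (hσ : 0 < σ) (hK : 0 < K) :
    ∃ B : ℝ, 0 < B ∧ ∀ τ : ℝ, 0 < τ → τ ≤ T →
      (∀ x, |logGamma σ r K τ x| ≤ B / Real.sqrt τ) ∧
      (∫⁻ x, ‖logGamma σ r K τ x‖ₑ ≤ ENNReal.ofReal B) ∧
      (∫⁻ x, ‖logFlux σ r K τ x‖ₑ ≤ ENNReal.ofReal (B / Real.sqrt τ)) ∧
      (∀ x, |logFluxDeriv σ r K τ x| ≤ B / τ / Real.sqrt τ) ∧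
      (∫⁻ x, ‖logFluxDeriv σ r K τ x‖ₑ ≤ ENNReal.ofReal (B / τ)) := by
  set c := |r - σ ^ 2 / 2| with hc
  set M : ℝ := 1 + σ / 2 + 2 + c * Real.sqrt T + c / σ * Real.sqrt T with hMdef
  have hc0 : 0 ≤ c := abs_nonneg _
  have hM1 : 1 ≤ M := by
    have : 0 ≤ σ / 2 + 2 + c * Real.sqrt T + c / σ * Real.sqrt T := by positivity
    linarith
  have hM0 : 0 ≤ M := by linarith
  set m := K / σ + 2 * K * Real.sqrt Real.pi with hm
  have hpi : 0 ≤ 2 * K * Real.sqrt Real.pi := by positivity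
  have hKσ : 0 < K / σ := by positivity
  have hm0 : 0 < m := by linarith
  refine ⟨M * m, by positivity, fun τ hτ hτT => ?_⟩
  have hs : 0 < Real.sqrt τ := Real.sqrt_pos.2 hτ
  have hq : Real.sqrt τ * Real.sqrt τ = τ := Real.mul_self_sqrt hτ.le
  have hsT : Real.sqrt τ ≤ Real.sqrt T := Real.sqrt_le_sqrt hτT
  have hE : ∀ x, 0 ≤ gaussEnvelope σ r K τ x := gaussEnvelope_nonneg hσ hK
  have hES : ∀ x, gaussEnvelope σ r K τ x ≤ m / Real.sqrt τ := fun x =>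
    (gaussEnvelope_le hσ hK x).trans (by gcongr; linarith)
  have hg : ∀ x, |logGamma σ r K τ x| ≤ M * gaussEnvelope σ r K τ x := fun x =>
    (abs_logGamma_le hσ hK x).trans (le_mul_of_one_le_left (hE x) hM1)
  have hG : ∀ x, |logFlux σ r K τ x| ≤ M / Real.sqrt τ * gaussEnvelope σ r K τ x := by
    intro x
    have h1 := abs_logGammaDeriv_le (r := r) hσ hK hτ x
    have h0 := abs_logGamma_le (r := r) (τ := τ) hσ hK x
    calc |logFlux σ r K τ x|
        ≤ σ ^ 2 / 2 * |logGammaDeriv σ r K τ x| + c * |logGamma σ r K τ x| := by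
          refine (abs_add_le _ _).trans_eq ?_
          rw [abs_mul, abs_mul, abs_of_nonneg (by positivity : 0 ≤ σ ^ 2 / 2)]
      _ ≤ σ ^ 2 / 2 * (1 / (σ * Real.sqrt τ) * gaussEnvelope σ r K τ x) +
            c * gaussEnvelope σ r K τ x := by gcongr
      _ = (σ / 2 + c * Real.sqrt τ) / Real.sqrt τ * gaussEnvelope σ r K τ x := by
          field_simp
      _ ≤ M / Real.sqrt τ * gaussEnvelope σ r K τ x := by
          have : σ / 2 + c * Real.sqrt τ ≤ M := by
            have h2 : c * Real.sqrt τ ≤ c * Real.sqrt T := by gcongr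
            have h3 : 0 ≤ c / σ * Real.sqrt T := by positivity
            linarith
          have := hE x
          gcongr
  have hH : ∀ x, |logFluxDeriv σ r K τ x| ≤ M / τ * gaussEnvelope σ r K τ x := by
    intro x
    have h2 := abs_logGammaDerivTwo_le (r := r) hσ hK hτ x
    have h1 := abs_logGammaDeriv_le (r := r) hσ hK hτ x
    calc |logFluxDeriv σ r K τ x|
        ≤ σ ^ 2 / 2 * |logGammaDerivTwo σ r K τ x| + c * |logGammaDeriv σ r K τ x| := by
          refine (abs_add_le _ _).trans_eq ?_
          rw [abs_mul, abs_mul, abs_of_nonneg (by positivity : 0 ≤ σ ^ 2 / 2)]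
      _ ≤ σ ^ 2 / 2 * (4 / (σ ^ 2 * τ) * gaussEnvelope σ r K τ x) +
            c * (1 / (σ * Real.sqrt τ) * gaussEnvelope σ r K τ x) := by gcongr
      _ = (2 + c / σ * Real.sqrt τ) / τ * gaussEnvelope σ r K τ x := by
          have : 1 / (σ * Real.sqrt τ) = Real.sqrt τ / (σ * τ) := by
            rw [div_eq_div_iff (by positivity) (by positivity)]; linear_combination (-σ) * hq
          rw [this]
          field_simp
          ring
      _ ≤ M / τ * gaussEnvelope σ r K τ x := by
          have : 2 + c / σ * Real.sqrt τ ≤ M := by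
            have h2 : c / σ * Real.sqrt τ ≤ c / σ * Real.sqrt T := by gcongr
            have h3 : 0 ≤ c * Real.sqrt T := by positivity
            linarith
          have := hE x
          gcongr
  have hmono : ∀ {a : ℝ}, 0 ≤ a → a * (2 * K * Real.sqrt Real.pi) ≤ a * m := fun ha => by
    gcongr; linarith
  refine ⟨fun x => ?_, ?_, ?_, fun x => ?_, ?_⟩
  · refine (hg x).trans ?_
    rw [mul_div_assoc]
    gcongr
    exact hES x
  · exact (lintegral_enorm_le_of_abs_le hσ hK hτ hM0 hg).trans
      (ENNReal.ofReal_le_ofReal (hmono hM0))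
  · refine (lintegral_enorm_le_of_abs_le hσ hK hτ (by positivity) hG).trans
      (ENNReal.ofReal_le_ofReal ((hmono (by positivity)).trans_eq ?_))
    ring
  · refine (hH x).trans ?_
    calc M / τ * gaussEnvelope σ r K τ x ≤ M / τ * (m / Real.sqrt τ) := by
          gcongr
          exact hES x
      _ = M * m / τ / Real.sqrt τ := by ring
  · refine (lintegral_enorm_le_of_abs_le hσ hK hτ (by positivity) hH).trans
      (ENNReal.ofReal_le_ofReal ((hmono (by positivity)).trans_eq ?_))
    ring

/-! ### Bounds for the jump integrands of the price and of its time derivative -/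

/-- With `q = √τ` the diffusive scale: bounds of the jump integrands in `L^∞` and `L¹` of the
space variable, by multiples of `jumpWeight`. -/
theorem exists_jump_bounds {σ K : ℝ} (r : ℝ) {T γ : ℝ} (hσ : 0 < σ) (hK : 0 < K)
    (hγ : 1 / 2 ≤ γ) (hγ' : γ < 1) :
    ∃ C : ℝ, 0 < C ∧ ∀ τ : ℝ, 0 < τ → τ ≤ T → ∀ ε z : ℝ,
      (∀ x, |priceJump σ r K ε τ x z| ≤
        C * Real.sqrt τ ^ (-(2 * γ - 1)) * jumpWeight γ z) ∧
      (∫⁻ x, ‖priceJump σ r K ε τ x z‖ₑ ≤ ENNReal.ofReal (C * jumpWeight γ z)) ∧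
      (∀ x, |thetaJump σ r K ε τ x z| ≤
        C * Real.sqrt τ ^ (-(2 * γ - 1)) / τ * jumpWeight γ z) ∧
      (∫⁻ x, ‖thetaJump σ r K ε τ x z‖ₑ ≤
        ENNReal.ofReal (C * Real.sqrt τ ^ (-(2 * γ - 1)) / Real.sqrt τ * jumpWeight γ z)) := by
  obtain ⟨B, hB, hbd⟩ := exists_gauss_bounds r (T := T) hσ hK
  refine ⟨2 * B, by positivity, fun τ hτ hτT ε z => ?_⟩
  obtain ⟨hg, hgL, hGL, hh, hhL⟩ := hbd τ hτ hτT
  have hs : 0 < Real.sqrt τ := Real.sqrt_pos.2 hτ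
  have hq : Real.sqrt τ * Real.sqrt τ = τ := Real.mul_self_sqrt hτ.le
  set q := Real.sqrt τ with hqdef
  set e := Real.exp (max z 0) with he
  have he0 : 0 < e := Real.exp_pos _
  set R := q ^ (-(2 * γ - 1)) with hR
  have hR0 : 0 < R := by positivity
  set W := jumpWeight γ z with hW
  have hW0 : 0 ≤ W := jumpWeight_nonneg γ z
  have hM0 : 0 ≤ |z| * e := by positivity
  -- the interpolation step between small and large jumps
  have hint : |z| * e * min (|z| / q) 1 ≤ R * W := by
    calc |z| * e * min (|z| / q) 1 = e * (|z| * min (|z| / q) 1) := by ring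
      _ ≤ e * (|z| ^ (2 * γ) * R) :=
          mul_le_mul_of_nonneg_left (mul_min_le_rpow hγ hγ' (abs_nonneg z) hs) he0.le
      _ = R * (|z| ^ (2 * γ) * e) := by ring
      _ ≤ R * W := mul_le_mul_of_nonneg_left (rpow_mul_exp_le_jumpWeight γ z) hR0.le
  have ha : ∀ s ∈ Set.uIoc 0 z, |Real.exp (z - s) - 1| ≤ |z| * e := fun s hs =>
    abs_exp_sub_sub_one_le hs
  have hprice : ∀ x, priceJump σ r K ε τ x z =
      ∫ s in 0..z, (Real.exp (z - s) - 1) * logGamma σ r K τ (x + s) := fun x => by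
    rw [← jumpIntegrand_logPrice_eq_priceJump r K ε hσ hτ, jumpIntegrand_logPrice r K ε hσ hτ]
  have htheta : ∀ x, thetaJump σ r K ε τ x z =
      ∫ s in 0..z, (Real.exp (z - s) - 1) * logFluxDeriv σ r K τ (x + s) := fun x => by
    rw [← jumpIntegrand_logTheta_eq_thetaJump r K ε hσ hτ, jumpIntegrand_logTheta r K ε hσ hτ]
  refine ⟨fun x => ?_, ?_, fun x => ?_, ?_⟩
  · rw [hprice]
    have e1 : min (|z| * (B / q)) B = B * min (|z| / q) 1 := by
      rw [mul_min_of_nonneg _ _ hB.le, mul_one]; congr 1; ring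
    refine (abs_integral_mul_le_min x hM0 hB.le ha hg hgL).trans ?_
    rw [e1]
    calc |z| * e * (B * min (|z| / q) 1) = B * (|z| * e * min (|z| / q) 1) := by ring
      _ ≤ B * (R * W) := by gcongr
      _ ≤ 2 * B * R * W := by nlinarith [mul_nonneg (mul_nonneg hB.le hR0.le) hW0]
  · simp_rw [hprice]
    refine (lintegral_enorm_integral_mul_le hM0 ha (continuous_logGamma r K).measurable
      hgL).trans (ENNReal.ofReal_le_ofReal ?_)
    calc |z| * (|z| * e) * B = B * (z ^ 2 * e) := by rw [← sq_abs]; ring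
      _ ≤ B * W := mul_le_mul_of_nonneg_left (sq_mul_exp_le_jumpWeight γ z) hB.le
      _ ≤ 2 * B * W := by nlinarith [mul_nonneg hB.le hW0]
  · rw [htheta]
    have e1 : min (|z| * (B / τ / q)) (B / τ) = B / τ * min (|z| / q) 1 := by
      rw [mul_min_of_nonneg _ _ (by positivity), mul_one]; congr 1; ring
    refine (abs_integral_mul_le_min x hM0 (by positivity) ha hh hhL).trans ?_
    rw [e1]
    calc |z| * e * (B / τ * min (|z| / q) 1) = B / τ * (|z| * e * min (|z| / q) 1) := by ring
      _ ≤ B / τ * (R * W) := by gcongr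
      _ ≤ 2 * (B / τ * (R * W)) := by
          have : 0 ≤ B / τ * (R * W) := by positivity
          linarith
      _ = 2 * B * R / τ * W := by ring
  · -- jumps below the scale `q`: no cancellation is needed; above it, integrate by parts
    have hsmall : ∫⁻ x, ‖thetaJump σ r K ε τ x z‖ₑ ≤
        ENNReal.ofReal (2 * B / q * (|z| * e * (|z| / q))) := by
      simp_rw [htheta]
      refine (lintegral_enorm_integral_mul_le hM0 ha (continuous_logFluxDeriv r K).measurable
        hhL).trans (ENNReal.ofReal_le_ofReal ?_)
      have e2 : |z| * (|z| * e) * (B / τ) = B / q * (|z| * e * (|z| / q)) := by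
        rw [← hq]; field_simp
      have : 0 ≤ B / q * (|z| * e * (|z| / q)) := by positivity
      calc |z| * (|z| * e) * (B / τ) = B / q * (|z| * e * (|z| / q)) := e2
        _ ≤ 2 * (B / q * (|z| * e * (|z| / q))) := by linarith
        _ = _ := by ring
    have hlarge : ∫⁻ x, ‖thetaJump σ r K ε τ x z‖ₑ ≤
        ENNReal.ofReal (2 * B / q * (|z| * e * 1)) := by
      have hparts : ∀ x, thetaJump σ r K ε τ x z =
          (∫ s in 0..z, Real.exp (z - s) * logFlux σ r K τ (x + s)) -
            (Real.exp z - 1) * logFlux σ r K τ x := fun x => by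
        rw [htheta, integral_exp_sub_one_mul_deriv (hasDerivAt_logFlux r K)
          (continuous_logFluxDeriv r K)]
      have h1 : ∫⁻ x, ‖∫ s in 0..z, Real.exp (z - s) * logFlux σ r K τ (x + s)‖ₑ ≤
          ENNReal.ofReal (|z| * e * (B / q)) :=
        lintegral_enorm_integral_mul_le he0.le (fun s hs => abs_exp_sub_le hs)
          (continuous_logFlux r K).measurable hGL
      have hmeas : Measurable fun x => ‖(Real.exp z - 1) * logFlux σ r K τ x‖ₑ :=
        ((continuous_logFlux r K).measurable.const_mul _).enorm
      have h2 : ∫⁻ x, ‖(Real.exp z - 1) * logFlux σ r K τ x‖ₑ ≤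
          ENNReal.ofReal (|z| * e * (B / q)) := by
        simp_rw [enorm_mul]
        rw [lintegral_const_mul' _ _ (by simp), ENNReal.ofReal_mul hM0]
        refine mul_le_mul' ?_ hGL
        rw [Real.enorm_eq_ofReal_abs]
        exact ENNReal.ofReal_le_ofReal (abs_exp_sub_one_le z)
      calc ∫⁻ x, ‖thetaJump σ r K ε τ x z‖ₑ
          ≤ ∫⁻ x, (‖∫ s in 0..z, Real.exp (z - s) * logFlux σ r K τ (x + s)‖ₑ +
              ‖(Real.exp z - 1) * logFlux σ r K τ x‖ₑ) :=
            lintegral_mono fun x => by rw [hparts]; exact enorm_sub_le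
        _ ≤ ENNReal.ofReal (|z| * e * (B / q)) + ENNReal.ofReal (|z| * e * (B / q)) := by
            rw [lintegral_add_right _ hmeas]
            exact add_le_add h1 h2
        _ = ENNReal.ofReal (2 * B / q * (|z| * e * 1)) := by
            rw [← ENNReal.ofReal_add (by positivity) (by positivity)]
            ring_nf
    have hmin : ∫⁻ x, ‖thetaJump σ r K ε τ x z‖ₑ ≤
        ENNReal.ofReal (2 * B / q * (|z| * e * min (|z| / q) 1)) := by
      rcases min_choice (|z| / q) 1 with h | h <;> rw [h]
      · exact hsmall
      · exact hlarge
    refine hmin.trans (ENNReal.ofReal_le_ofReal ?_)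
    calc 2 * B / q * (|z| * e * min (|z| / q) 1) ≤ 2 * B / q * (R * W) := by gcongr
      _ = 2 * B * R / q * W := by ring

/-! ### From bounds of the integrand to bounds of the integral over the jumps -/

section JumpIntegral

variable {ν : Measure ℝ} {J : ℝ → ℝ → ℝ} {W : ℝ → ℝ} {S L I p : ℝ}

theorem lintegral_enorm_le_of_weight (hS : 0 ≤ S)
    (hI : ∫⁻ z, ENNReal.ofReal (W z) ∂ν ≤ ENNReal.ofReal I)
    (hJS : ∀ z x, |J x z| ≤ S * W z) (x : ℝ) :
    ∫⁻ z, ‖J x z‖ₑ ∂ν ≤ ENNReal.ofReal (S * I) := by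
  rw [ENNReal.ofReal_mul hS]
  refine le_trans ?_ (mul_le_mul_right hI _)
  rw [← lintegral_const_mul' _ _ ENNReal.ofReal_ne_top]
  refine lintegral_mono fun z => ?_
  rw [Real.enorm_eq_ofReal_abs, ← ENNReal.ofReal_mul hS]
  exact ENNReal.ofReal_le_ofReal (hJS z x)

theorem integrable_of_weight (hJ : Measurable (Function.uncurry J)) (hS : 0 ≤ S)
    (hI : ∫⁻ z, ENNReal.ofReal (W z) ∂ν ≤ ENNReal.ofReal I)
    (hJS : ∀ z x, |J x z| ≤ S * W z) (x : ℝ) : Integrable (J x) ν :=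
  ⟨(hJ.comp measurable_prodMk_left).aestronglyMeasurable,
    (lintegral_enorm_le_of_weight hS hI hJS x).trans_lt ENNReal.ofReal_lt_top⟩

theorem lintegral_rpow_lintegral_enorm_le [SFinite ν] (hJ : Measurable (Function.uncurry J))
    (hp : 1 ≤ p) (hS : 0 ≤ S) (hL : 0 ≤ L) (hI0 : 0 ≤ I)
    (hI : ∫⁻ z, ENNReal.ofReal (W z) ∂ν ≤ ENNReal.ofReal I)
    (hJS : ∀ z x, |J x z| ≤ S * W z)
    (hJL : ∀ z, ∫⁻ x, ‖J x z‖ₑ ≤ ENNReal.ofReal (L * W z)) :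
    ∫⁻ x, (∫⁻ z, ‖J x z‖ₑ ∂ν) ^ p ≤ ENNReal.ofReal ((S * I) ^ (p - 1) * (L * I)) := by
  refine lintegral_rpow_le_of_le hp (by positivity)
    (fun x => lintegral_enorm_le_of_weight hS hI hJS x) ?_
  rw [lintegral_lintegral_swap hJ.enorm.aemeasurable, ENNReal.ofReal_mul hL]
  refine le_trans ?_ (mul_le_mul_right hI _)
  rw [← lintegral_const_mul' _ _ ENNReal.ofReal_ne_top]
  refine lintegral_mono fun z => (hJL z).trans_eq ?_
  rw [ENNReal.ofReal_mul hL]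

theorem eLpNorm_le_of_lintegral_rpow_le {F : ℝ → ℝ} {Φ : ℝ → ENNReal} {M : ℝ} (hp : 1 ≤ p)
    (hM : 0 ≤ M) (hF : ∀ x, ‖F x‖ₑ ≤ Φ x) (hΦ : ∫⁻ x, Φ x ^ p ≤ ENNReal.ofReal (M ^ p)) :
    eLpNorm F (ENNReal.ofReal p) volume ≤ ENNReal.ofReal M := by
  have hp0 : 0 < p := by linarith
  rw [eLpNorm_eq_lintegral_rpow_enorm_toReal (by simpa using hp0) ENNReal.ofReal_ne_top,
    ENNReal.toReal_ofReal hp0.le]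
  calc (∫⁻ x, ‖F x‖ₑ ^ p) ^ (1 / p) ≤ (ENNReal.ofReal (M ^ p)) ^ (1 / p) := by
        refine ENNReal.rpow_le_rpow ((lintegral_mono fun x => ?_).trans hΦ) (by positivity)
        exact ENNReal.rpow_le_rpow (hF x) hp0.le
    _ = ENNReal.ofReal M := by
        rw [ENNReal.ofReal_rpow_of_nonneg (by positivity) (by positivity), ← Real.rpow_mul hM,
          mul_one_div_cancel hp0.ne', Real.rpow_one]

theorem aestronglyMeasurable_integral_jump [SFinite ν] (hJ : Measurable (Function.uncurry J)) :
    AEStronglyMeasurable (fun x => ∫ z, J x z ∂ν) volume :=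
  (hJ.stronglyMeasurable.integral_prod_right).aestronglyMeasurable

end JumpIntegral

theorem IsAdmissibleLevyMeasure.sFinite {ν : Measure ℝ} {A α Dminus Dplus μ : ℝ}
    (hν : IsAdmissibleLevyMeasure ν A α Dminus Dplus μ) : SFinite ν := by
  obtain ⟨h, _, _, _, rfl⟩ := hν.exists_density
  infer_instance

/-! ### `L^p` bounds -/

/-- The powers of `τ` in the interpolation inequality `‖F‖_p^p ≤ ‖F‖_∞^{p-1} ‖F‖_1`. -/
theorem mul_rpow_rpow_sub_one_mul {p τ M s l e : ℝ} (hτ : 0 < τ) (hM : 0 < M)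
    (he : e * p = s * (p - 1) + l) :
    (M * τ ^ s) ^ (p - 1) * (M * τ ^ l) = (M * τ ^ e) ^ p := by
  rw [Real.mul_rpow hM.le (by positivity), Real.mul_rpow hM.le (by positivity),
    ← Real.rpow_mul hτ.le, ← Real.rpow_mul hτ.le, he, Real.rpow_add hτ, mul_mul_mul_comm,
    ← Real.rpow_add_one hM.ne', sub_add_cancel]

theorem measurable_uncurry_priceJump {σ : ℝ} (r K ε τ : ℝ) :
    Measurable (Function.uncurry (priceJump σ r K ε τ)) := by
  simp only [Function.uncurry_def]
  exact measurable_priceJump_comp r K ε measurable_const measurable_fst measurable_snd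

theorem measurable_uncurry_thetaJump {σ : ℝ} (r K ε τ : ℝ) :
    Measurable (Function.uncurry (thetaJump σ r K ε τ)) := by
  simp only [Function.uncurry_def]
  exact measurable_thetaJump_comp r K ε measurable_const measurable_fst measurable_snd

section LpBounds

variable {σ K T γ p : ℝ}

/-- Interpolating `exists_jump_bounds` between `L¹` and `L^∞` gives both `L^p` bounds; the
integrals over the jumps are still taken in absolute value. -/
theorem exists_Lp_jump_bounds (r A : ℝ) {α Dminus Dplus μ : ℝ} (hσ : 0 < σ) (hK : 0 < K)
    (hp : 1 ≤ p) (hα : α < 3) (hshape : 0 < μ ∨ (μ = 0 ∧ Dminus + 1 < 0 ∧ 0 < Dplus))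
    (hγ_half : 1 / 2 ≤ γ) (hγ_one : γ < 1) (hγ_lower : (α - 1) / 2 < γ) :
    ∃ M : ℝ, 0 < M ∧ ∀ ν : Measure ℝ, IsAdmissibleLevyMeasure ν A α Dminus Dplus μ →
      ∀ ε τ : ℝ, 0 < τ → τ ≤ T →
        (∀ x, Integrable (priceJump σ r K ε τ x) ν) ∧
        (∀ x, Integrable (thetaJump σ r K ε τ x) ν) ∧
        (∫⁻ x, (∫⁻ z, ‖priceJump σ r K ε τ x z‖ₑ ∂ν) ^ p ≤
          ENNReal.ofReal ((M * τ ^ (-(2 * γ - 1) * (1 / 2 - 1 / (2 * p)))) ^ p)) ∧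
        (∫⁻ x, (∫⁻ z, ‖thetaJump σ r K ε τ x z‖ₑ ∂ν) ^ p ≤
          ENNReal.ofReal ((M * τ ^ (-γ - 1 / 2 + 1 / (2 * p))) ^ p)) := by
  have hp0 : 0 < p := by linarith
  obtain ⟨I, hI0, hIν⟩ := exists_lintegral_jumpWeight_le (A := A) (Dminus := Dminus)
    (Dplus := Dplus) (μ := μ) hα hshape hγ_lower
  obtain ⟨B, hB, hbd⟩ := exists_jump_bounds r (T := T) (σ := σ) (K := K) hσ hK hγ_half hγ_one
  refine ⟨B * I, by positivity, fun ν hν ε τ hτ hτT => ?_⟩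
  have := hν.sFinite
  have hI := hIν ν hν
  have hsq : Real.sqrt τ ^ (-(2 * γ - 1)) = τ ^ (-(γ - 1 / 2)) := by
    rw [Real.sqrt_eq_rpow, ← Real.rpow_mul hτ.le]; ring_nf
  have hmeasP := measurable_uncurry_priceJump (σ := σ) r K ε τ
  have hmeasT := measurable_uncurry_thetaJump (σ := σ) r K ε τ
  have hS := fun z => (hbd τ hτ hτT ε z).1
  have hL := fun z => (hbd τ hτ hτT ε z).2.1
  have hS' := fun z => (hbd τ hτ hτT ε z).2.2.1
  have hL' := fun z => (hbd τ hτ hτT ε z).2.2.2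
  have hM0 : 0 < B * I := by positivity
  refine ⟨integrable_of_weight hmeasP (by positivity) hI hS,
    integrable_of_weight hmeasT (by positivity) hI hS', ?_, ?_⟩
  · refine (lintegral_rpow_lintegral_enorm_le hmeasP hp (by positivity) hB.le hI0.le hI
      hS hL).trans_eq ?_
    have e : -(2 * γ - 1) * (1 / 2 - 1 / (2 * p)) * p = -(γ - 1 / 2) * (p - 1) + 0 := by
      field_simp
      ring
    rw [← mul_rpow_rpow_sub_one_mul hτ hM0 e, Real.rpow_zero, mul_one, hsq, mul_right_comm B]
  · refine (lintegral_rpow_lintegral_enorm_le hmeasT hp (by positivity) (by positivity) hI0.le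
      hI hS' hL').trans_eq ?_
    have e1 : B * Real.sqrt τ ^ (-(2 * γ - 1)) / τ * I = B * I * τ ^ (-γ - 1 / 2) := by
      have : τ ^ (-(γ - 1 / 2)) / τ = τ ^ (-γ - 1 / 2) := by
        rw [← Real.rpow_sub_one hτ.ne']; ring_nf
      rw [hsq, mul_div_assoc, this]; ring
    have e2 : B * Real.sqrt τ ^ (-(2 * γ - 1)) / Real.sqrt τ * I = B * I * τ ^ (-γ) := by
      have : τ ^ (-(γ - 1 / 2)) / Real.sqrt τ = τ ^ (-γ) := by
        rw [Real.sqrt_eq_rpow, ← Real.rpow_sub hτ]; ring_nf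
      rw [hsq, mul_div_assoc, this]; ring
    have e : (-γ - 1 / 2 + 1 / (2 * p)) * p = (-γ - 1 / 2) * (p - 1) + -γ := by
      field_simp
      ring
    rw [e1, e2, mul_rpow_rpow_sub_one_mul hτ hM0 e]

end LpBounds

/-! ### Increments in time -/

theorem enorm_sub_le_lintegral_of_hasDerivAt {f f' : ℝ → ℝ} {a b : ℝ} (hab : a ≤ b)
    (hf : ∀ t ∈ Set.Icc a b, HasDerivAt f (f' t) t) (hf' : Measurable f') :
    ‖f b - f a‖ₑ ≤ ∫⁻ t in Set.Ioc a b, ‖f' t‖ₑ := by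
  by_cases htop : ∫⁻ t in Set.Ioc a b, ‖f' t‖ₑ = ⊤
  · rw [htop]; exact le_top
  have hint : IntervalIntegrable f' volume a b :=
    (intervalIntegrable_iff_integrableOn_Ioc_of_le hab).2
      ⟨hf'.aestronglyMeasurable, lt_top_iff_ne_top.2 htop⟩
  rw [← intervalIntegral.integral_eq_sub_of_hasDerivAt
    (fun t ht => hf t (by rwa [Set.uIcc_of_le hab] at ht)) hint,
    intervalIntegral.integral_of_le hab]
  exact enorm_integral_le_lintegral_enorm _

/-- An increment of `f[u]` in `τ` is the time integral of `f[∂_τ u]`. Its `L^p` norm is estimated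
by integrating the singular bound `M τ^{-a}`, not by interpolation: near `τ = 0` the `L^∞` bound of
`f[∂_τ u]` is not integrable. -/
theorem eLpNorm_integral_priceJump_sub_le {σ r K ε T p a M t₁ t₂ : ℝ} {ν : Measure ℝ} [SFinite ν]
    (hσ : 0 < σ) (hp : 1 ≤ p) (ha0 : 0 ≤ a) (ha1 : a < 1) (hM : 0 ≤ M)
    (hint : ∀ τ : ℝ, 0 < τ → τ ≤ T → ∀ x, Integrable (priceJump σ r K ε τ x) ν)
    (hLp : ∀ τ : ℝ, 0 < τ → τ ≤ T → ∫⁻ x, (∫⁻ z, ‖thetaJump σ r K ε τ x z‖ₑ ∂ν) ^ p ≤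
      ENNReal.ofReal ((M * τ ^ (-a)) ^ p))
    (h₁ : t₁ ≤ T) (h₂ : 0 < t₂) (h₂₁ : t₂ ≤ t₁) :
    eLpNorm (fun x => (∫ z, priceJump σ r K ε t₁ x z ∂ν) - ∫ z, priceJump σ r K ε t₂ x z ∂ν)
      (ENNReal.ofReal p) volume ≤ ENNReal.ofReal (M / (1 - a) * (t₁ - t₂) ^ (1 - a)) := by
  have hp0 : 0 < p := by linarith
  have ha1' : 0 < 1 - a := by linarith
  have hd : 0 ≤ t₁ - t₂ := by linarith
  set Φ : ℝ → ℝ → ENNReal := fun τ x => ∫⁻ z, ‖thetaJump σ r K ε τ x z‖ₑ ∂ν with hΦ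
  have hΦm : Measurable (Function.uncurry Φ) := by
    refine Measurable.lintegral_prod_right' (f := fun q : (ℝ × ℝ) × ℝ =>
      ‖thetaJump σ r K ε q.1.1 q.1.2 q.2‖ₑ) ?_
    exact (measurable_thetaJump_comp r K ε (by fun_prop) (by fun_prop) (by fun_prop)).enorm
  have hinc : ∀ x z, ‖priceJump σ r K ε t₁ x z - priceJump σ r K ε t₂ x z‖ₑ ≤
      ∫⁻ τ in Set.Ioc t₂ t₁, ‖thetaJump σ r K ε τ x z‖ₑ := fun x z =>
    enorm_sub_le_lintegral_of_hasDerivAt (f := fun τ => priceJump σ r K ε τ x z) h₂₁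
      (fun τ hτ => hasDerivAt_priceJump_time r K ε hσ (h₂.trans_le hτ.1) x z)
      (measurable_thetaJump_comp r K ε measurable_id measurable_const measurable_const)
  have hF : ∀ x, ‖(∫ z, priceJump σ r K ε t₁ x z ∂ν) - ∫ z, priceJump σ r K ε t₂ x z ∂ν‖ₑ ≤
      ∫⁻ τ in Set.Ioc t₂ t₁, Φ τ x := by
    intro x
    have hsw : ∫⁻ z, (∫⁻ τ in Set.Ioc t₂ t₁, ‖thetaJump σ r K ε τ x z‖ₑ) ∂ν =
        ∫⁻ τ in Set.Ioc t₂ t₁, Φ τ x := by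
      refine lintegral_lintegral_swap (Measurable.aemeasurable ?_)
      exact (measurable_thetaJump_comp r K ε measurable_snd measurable_const
        measurable_fst).enorm
    rw [← hsw, ← integral_sub (hint t₁ (h₂.trans_le h₂₁) h₁ x) (hint t₂ h₂ (h₂₁.trans h₁) x)]
    exact (enorm_integral_le_lintegral_enorm _).trans (lintegral_mono (hinc x))
  refine eLpNorm_le_of_lintegral_rpow_le hp (by positivity) hF ?_
  refine (lintegral_rpow_lintegral_le (a := a) hΦm hp hM h₂ (fun τ hτ => ?_)).trans ?_
  · have hτ0 : 0 < τ := h₂.trans hτ.1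
    refine (hLp τ hτ0 (hτ.2.trans h₁)).trans_eq ?_
    rw [Real.mul_rpow hM (by positivity), ← Real.rpow_mul hτ0.le]
  · calc _ ≤ ENNReal.ofReal (M ^ p) *
          ENNReal.ofReal ((t₁ - t₂) ^ (1 - a) / (1 - a)) ^ p := by
          gcongr
          exact setLIntegral_rpow_neg_le ha0 ha1 h₂ h₂₁
      _ = ENNReal.ofReal ((M / (1 - a) * (t₁ - t₂) ^ (1 - a)) ^ p) := by
          rw [ENNReal.ofReal_rpow_of_nonneg (by positivity) hp0.le,
            ← ENNReal.ofReal_mul (by positivity), ← Real.mul_rpow hM (by positivity)]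
          congr 2
          ring

section Operator

variable {σ K τ : ℝ} (r T : ℝ) (o : VanillaOption)

theorem jumpIntegrand_uBS (hσ : 0 < σ) (hK : 0 < K) (hτ : 0 < τ) (x : ℝ) :
    jumpIntegrand (uBS σ r K T o τ) x = priceJump σ r K (parityConst K o) τ x := by
  ext z
  rw [uBS_eq_logPrice σ r T hK, jumpIntegrand_logPrice_eq_priceJump r K _ hσ hτ]

theorem jumpIntegrand_dτuBS (hσ : 0 < σ) (hK : 0 < K) (hτ : 0 < τ) (x : ℝ) :
    jumpIntegrand (dτuBS σ r K T o τ) x = thetaJump σ r K (parityConst K o) τ x := by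
  ext z
  rw [dτuBS_eq_logTheta r K hσ hK T o hτ, jumpIntegrand_logTheta_eq_thetaJump r K _ hσ hτ]

theorem jumpOperator_uBS (ν : Measure ℝ) (hσ : 0 < σ) (hK : 0 < K) (hτ : 0 < τ) :
    jumpOperator ν (uBS σ r K T o τ) =
      fun x => ∫ z, priceJump σ r K (parityConst K o) τ x z ∂ν := by
  ext x
  rw [jumpOperator, jumpIntegrand_uBS r T o hσ hK hτ]

theorem jumpOperator_dτuBS (ν : Measure ℝ) (hσ : 0 < σ) (hK : 0 < K) (hτ : 0 < τ) :
    jumpOperator ν (dτuBS σ r K T o τ) =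
      fun x => ∫ z, thetaJump σ r K (parityConst K o) τ x z ∂ν := by
  ext x
  rw [jumpOperator, jumpIntegrand_dτuBS r T o hσ hK hτ]

end Operator

end BlackScholesPIDE

/-! ### The estimates for the jump operator -/

open BlackScholesPIDE in
theorem mainTheorem6
    (σ r K T p γ A α Dminus Dplus μ : ℝ)
    (hσ : 0 < σ) (hr : 0 ≤ r) (hK : 0 < K) (hT : 0 < T) (hp : 1 ≤ p)
    (hα : α < 3)
    (hshape : 0 < μ ∨ (μ = 0 ∧ Dminus + 1 < 0 ∧ 0 < Dplus))
    (hγ_half : 1 / 2 ≤ γ) (hγ_one : γ < 1)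
    (hγ_lower : (α - 1) / 2 < γ) (hγ_upper : γ < (p + 1) / (2 * p)) :
    ∃ C : ℝ, 0 < C ∧
      ∀ ν : MeasureTheory.Measure ℝ,
        BlackScholesPIDE.IsAdmissibleLevyMeasure ν A α Dminus Dplus μ →
      ∀ o : BlackScholesPIDE.VanillaOption,
        (∀ τ : ℝ, 0 < τ → τ ≤ T →
          BlackScholesPIDE.JumpIntegrable ν (BlackScholesPIDE.uBS σ r K T o τ) ∧
          MeasureTheory.MemLp
            (BlackScholesPIDE.jumpOperator ν (BlackScholesPIDE.uBS σ r K T o τ))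
            (ENNReal.ofReal p) MeasureTheory.volume ∧
          MeasureTheory.eLpNorm
            (BlackScholesPIDE.jumpOperator ν (BlackScholesPIDE.uBS σ r K T o τ))
            (ENNReal.ofReal p) MeasureTheory.volume
            ≤ ENNReal.ofReal (C * τ ^ (-(2 * γ - 1) * (1 / 2 - 1 / (2 * p))))) ∧
        (∀ τ : ℝ, 0 < τ → τ ≤ T →
          BlackScholesPIDE.JumpIntegrable ν (BlackScholesPIDE.dτuBS σ r K T o τ) ∧
          MeasureTheory.MemLp
            (BlackScholesPIDE.jumpOperator ν (BlackScholesPIDE.dτuBS σ r K T o τ))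
            (ENNReal.ofReal p) MeasureTheory.volume ∧
          MeasureTheory.eLpNorm
            (BlackScholesPIDE.jumpOperator ν (BlackScholesPIDE.dτuBS σ r K T o τ))
            (ENNReal.ofReal p) MeasureTheory.volume
            ≤ ENNReal.ofReal (C * τ ^ (-γ - 1 / 2 + 1 / (2 * p)))) ∧
        (∀ τ₁ τ₂ : ℝ, 0 < τ₁ → τ₁ ≤ T → 0 < τ₂ → τ₂ ≤ T →
          MeasureTheory.eLpNorm
            (fun x =>
              BlackScholesPIDE.jumpOperator ν (BlackScholesPIDE.uBS σ r K T o τ₁) x -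
              BlackScholesPIDE.jumpOperator ν (BlackScholesPIDE.uBS σ r K T o τ₂) x)
            (ENNReal.ofReal p) MeasureTheory.volume
            ≤ ENNReal.ofReal (C * |τ₁ - τ₂| ^ (-γ + (p + 1) / (2 * p)))) := by
  have hp0 : 0 < p := by linarith
  obtain ⟨M, hM, hbd⟩ := exists_Lp_jump_bounds (T := T) r A (Dminus := Dminus) (Dplus := Dplus)
    (μ := μ) hσ hK hp hα hshape hγ_half hγ_one hγ_lower
  -- the exponent of the second estimate is `-a`; the condition `γ < (p + 1) / (2p)` is `a < 1`
  obtain ⟨a, ha⟩ : ∃ a, a = γ + 1 / 2 - 1 / (2 * p) := ⟨_, rfl⟩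
  have hpinv : 1 / (2 * p) ≤ 1 / 2 := by
    apply one_div_le_one_div_of_le <;> linarith
  have hθ : -γ + (p + 1) / (2 * p) = 1 - a := by rw [ha]; field_simp; ring
  have hea : -γ - 1 / 2 + 1 / (2 * p) = -a := by rw [ha]; ring
  have ha0 : 0 ≤ a := by linarith
  have ha1 : a < 1 := by linarith
  have hMa : 0 < M / (1 - a) := div_pos hM (by linarith)
  have hC : 0 < M + M / (1 - a) := by linarith
  refine ⟨M + M / (1 - a), hC, fun ν hν o => ?_⟩
  have := hν.sFinite
  have hmono : ∀ {y : ℝ}, 0 ≤ y →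
      ENNReal.ofReal (M * y) ≤ ENNReal.ofReal ((M + M / (1 - a)) * y) := fun hy =>
    ENNReal.ofReal_le_ofReal (mul_le_mul_of_nonneg_right (by linarith) hy)
  rw [hea, hθ]
  simp only [hea] at hbd
  refine ⟨fun τ hτ hτT => ?_, fun τ hτ hτT => ?_, ?_⟩
  · obtain ⟨hint, -, hLp, -⟩ := hbd ν hν (parityConst K o) τ hτ hτT
    have hnorm := eLpNorm_le_of_lintegral_rpow_le hp (by positivity)
      (fun x => enorm_integral_le_lintegral_enorm (priceJump σ r K (parityConst K o) τ x)) hLp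
    rw [jumpOperator_uBS r T o ν hσ hK hτ]
    exact ⟨fun x => by rw [jumpIntegrand_uBS r T o hσ hK hτ]; exact hint x,
      ⟨aestronglyMeasurable_integral_jump (measurable_uncurry_priceJump r K _ τ),
        hnorm.trans_lt ENNReal.ofReal_lt_top⟩, hnorm.trans (hmono (by positivity))⟩
  · obtain ⟨-, hint, -, hLp⟩ := hbd ν hν (parityConst K o) τ hτ hτT
    have hnorm := eLpNorm_le_of_lintegral_rpow_le hp (by positivity)
      (fun x => enorm_integral_le_lintegral_enorm (thetaJump σ r K (parityConst K o) τ x)) hLp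
    rw [jumpOperator_dτuBS r T o ν hσ hK hτ]
    exact ⟨fun x => by rw [jumpIntegrand_dτuBS r T o hσ hK hτ]; exact hint x,
      ⟨aestronglyMeasurable_integral_jump (measurable_uncurry_thetaJump r K _ τ),
        hnorm.trans_lt ENNReal.ofReal_lt_top⟩, hnorm.trans (hmono (by positivity))⟩
  · have hmain : ∀ t₁ t₂ : ℝ, t₁ ≤ T → 0 < t₂ → t₂ ≤ t₁ →
        eLpNorm (fun x => jumpOperator ν (uBS σ r K T o t₁) x -
          jumpOperator ν (uBS σ r K T o t₂) x) (ENNReal.ofReal p) volume ≤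
        ENNReal.ofReal ((M + M / (1 - a)) * |t₁ - t₂| ^ (1 - a)) := by
      intro t₁ t₂ h₁ h₂ h₂₁
      rw [jumpOperator_uBS r T o ν hσ hK (h₂.trans_le h₂₁), jumpOperator_uBS r T o ν hσ hK h₂,
        abs_of_nonneg (sub_nonneg.2 h₂₁)]
      refine (eLpNorm_integral_priceJump_sub_le hσ hp ha0 ha1 hM.le
        (fun τ hτ hτT => (hbd ν hν (parityConst K o) τ hτ hτT).1)
        (fun τ hτ hτT => (hbd ν hν (parityConst K o) τ hτ hτT).2.2.2) h₁ h₂ h₂₁).trans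
        (ENNReal.ofReal_le_ofReal ?_)
      exact mul_le_mul_of_nonneg_right (by linarith) (Real.rpow_nonneg (sub_nonneg.2 h₂₁) _)
    intro t₁ t₂ h₁ h₁T h₂ h₂T
    rcases le_total t₂ t₁ with h | h
    · exact hmain t₁ t₂ h₁T h₂ h
    · rw [abs_sub_comm]
      exact (eLpNorm_sub_comm _ _ _ _).trans_le (hmain t₂ t₁ h₂T h₁ h)
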